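/- Proposition (Uniform bounds for the free Schrödinger flow). Work on $L^2(\mathbb{R}^3)=L^2(\mathbb{R}^3;\mathbb{C})$. For $\hbar>0$ and $t\in\mathbb{R}$ let $\mathcal{U}^\hbar(t)=e^{\frac{it\hbar}{2}\Delta}$, let $\langle x\rangle=(1+|x|^2)^{1/2}$, let $\langle x\rangle^\sigma$ be the corresponding multiplication operator and $\langle\hbar\nabla\rangle^\sigma=(1-\hbar^2\Delta)^{\sigma/2}$, both with their maximal domains. For a bounded operator $A$ put $\|A\|_{\mathfrak{L}^r_\hbar}=(2\pi\hbar)^{3/r}\|A\|_{\mathfrak{S}^r}$, where $\|A\|_{\mathfrak{S}^r}=(\mathrm{Tr}\,|A|^r)^{1/r}$ is the Schatten norm for $1\le r<\infty$ and the operator norm for $r=\infty$. If $W$ is one of the two weights above, we write $\|W\gamma_0W\|_{\mathfrak{L}^r_\hbar}$ for the norm of the bounded operator $B$ with $\gamma_0Wf\in\mathrm{Dom}(W)$ and $W\gamma_0Wf=Bf$ for all $f\in\mathrm{Dom}(W)$, and $\|W\gamma_0W\|_{\mathfrak{L}^r_\hbar}=\infty$ if there is no such $B$. The rescaled density $\rho^\hbar_A$,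 formally $\rho^\hbar_A(x)=(2\pi\hbar)^3A(x,x)$ with $A(x,x')$ the integral kernel of $A$, is the locally integrable function with $\int_S\rho^\hbar_A\,dx=(2\pi\hbar)^3\,\mathrm{Tr}(\mathbf 1_SA\mathbf 1_S)$ for every bounded measurable $S\subset\mathbb{R}^3$; it is said to exist if there is such a function and all the operators $\mathbf 1_SA\mathbf 1_S$ are of trace class. Let $1\le r\le\infty$, let $r'$ be the conjugate exponent, $\frac1r+\frac1{r'}=1$, and let $\sigma>\frac{3}{2r'}$. Then there is a constant $C_{\sigma,r}>0$ such that, for all $\hbar>0$, all $t\in\mathbb{R}$ and all bounded operators $\gamma_0$ on $L^2(\mathbb{R}^3)$, $$\big\|\rho^\hbar_{\mathcal{U}^\hbar(t)\gamma_0\mathcal{U}^\hbar(t)^*}\big\|_{L^r(\mathbb{R}^3)}\le C_{\sigma,r}\,\|\langle\hbar\nabla\rangle^\sigma\gamma_0\langle\hbar\nabla\rangle^\sigma\|_{\mathfrak{L}^r_\hbar},$$ and, if $t\ne0$ or $r=1$, $$\big\|\rho^\hbar_{\mathcal{U}^\hbar(t)\gamma_0\mathcal{U}^\hbar(t)^*}\big\|_{L^r(\mathbb{R}^3)}\le\frac{C_{\sigma,r}}{|t|^{3/r'}}\,\|\langle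 x\rangle^\sigma\gamma_0\langle x\rangle^\sigma\|_{\mathfrak{L}^r_\hbar}$$ (with $|t|^{3/r'}=1$ for $r=1$). In each case finiteness of the norm on the right-hand side implies that the density exists. -/

import Mathlib

open MeasureTheory
open scoped ENNReal FourierTransform InnerProductSpace

noncomputable section

namespace Semiclassical

section Schatten

variable {H : Type*} [NormedAddCommGroup H] [InnerProductSpace ℂ H] [CompleteSpace H]

/-- The index set of a chosen orthonormal (Hilbert) basis of `H`. -/
def basisIndex (H : Type*) [NormedAddCommGroup H] [InnerProductSpace ℂ H] [CompleteSpace H] :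
    Set H :=
  (exists_hilbertBasis ℂ H).choose

/-- A chosen orthonormal (Hilbert) basis of `H`. The traces below do not depend on the choice. -/
def chosenBasis (H : Type*) [NormedAddCommGroup H] [InnerProductSpace ℂ H] [CompleteSpace H] :
    HilbertBasis (basisIndex H) ℂ H :=
  (exists_hilbertBasis ℂ H).choose_spec.choose

/-- The trace `∑ᵢ ⟨eᵢ, T eᵢ⟩ ∈ [0, ∞]` of a non-negative operator `T`. -/
def posTrace (T : H →L[ℂ] H) : ℝ≥0∞ :=
  ∑' i, ENNReal.ofReal (⟪chosenBasis H i, T (chosenBasis H i)⟫_ℂ).re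

/-- The Schatten norm `‖A‖_{𝔖^r} = (Tr |A|^r)^{1/r}`, `|A| = √(A* A)`, with value `∞` outside the
Schatten class; for `r = ∞` it is the operator norm. -/
def schattenNorm (r : ℝ≥0∞) (A : H →L[ℂ] H) : ℝ≥0∞ :=
  if r = ∞ then ‖A‖ₑ else (posTrace (CFC.abs A ^ r.toReal)) ^ (1 / r.toReal)

/-- Trace class operators: `Tr |A| < ∞`. -/
def IsTraceClass (A : H →L[ℂ] H) : Prop := schattenNorm 1 A < ∞

/-- The trace `∑ᵢ ⟨eᵢ, A eᵢ⟩`; the sum converges absolutely for trace class `A`, and the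
definition is only used for such `A`. -/
def trace (A : H →L[ℂ] H) : ℂ := ∑' i, ⟪chosenBasis H i, A (chosenBasis H i)⟫_ℂ

/-- `B` is the bounded operator `W A W`, where `W` is an unbounded operator: for every `f` in the
domain of `W`, the vector `A W f` lies in the domain of `W`, and `W A W f = B f`. -/
def IsSandwich (W : H →ₗ.[ℂ] H) (A B : H →L[ℂ] H) : Prop :=
  ∀ f : W.domain, ∃ h : A (W f) ∈ W.domain, W ⟨A (W f), h⟩ = B f

/-- The semiclassical Schatten norm `‖A‖_{𝔏^r_ħ} = (2πħ)^{3/r} ‖A‖_{𝔖^r}`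
(in three space dimensions). -/
def scaledSchattenNorm (ħ : ℝ) (r : ℝ≥0∞) (A : H →L[ℂ] H) : ℝ≥0∞ :=
  ENNReal.ofReal ((2 * Real.pi * ħ) ^ (3 * (r⁻¹).toReal)) * schattenNorm r A

/-- `‖W A W‖_{𝔏^r_ħ}` for an unbounded (densely defined) `W`; the value is `∞` if `W A W` is not a
bounded operator. The operator `B = W A W` is unique, so that the infimum is over one operator at
most. -/
def sandwichNorm (ħ : ℝ) (r : ℝ≥0∞) (W : H →ₗ.[ℂ] H) (A : H →L[ℂ] H) : ℝ≥0∞ :=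
  ⨅ (B : H →L[ℂ] H) (_ : IsSandwich W A B), scaledSchattenNorm ħ r B

end Schatten

/-- Three-dimensional Euclidean space. -/
abbrev E3 : Type := EuclideanSpace ℝ (Fin 3)

/-- The Hilbert space `L²(ℝ³; ℂ)`. -/
abbrev L2 : Type := Lp ℂ 2 (volume : Measure E3)

theorem mul_add_ae (m : E3 → ℂ) (f g : L2) :
    (fun x => m x * (f + g : L2) x) =ᵐ[volume] (fun x => m x * f x) + fun x => m x * g x := by
  filter_upwards [Lp.coeFn_add f g] with x hx
  simp only [hx, Pi.add_apply, mul_add]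

theorem mul_smul_ae (m : E3 → ℂ) (c : ℂ) (f : L2) :
    (fun x => m x * (c • f : L2) x) =ᵐ[volume] c • fun x => m x * f x := by
  filter_upwards [Lp.coeFn_smul c f] with x hx
  simp only [hx, Pi.smul_apply, smul_eq_mul, mul_left_comm]

/-- Multiplication by the function `m`, with its maximal domain
`{f ∈ L² : m f ∈ L²}`, as an unbounded operator on `L²`. -/
def mulOp (m : E3 → ℂ) : L2 →ₗ.[ℂ] L2 where
  domain :=
    { carrier := {f | MemLp (fun x => m x * f x) 2 volume}
      zero_mem' := by
        refine (memLp_congr_ae ?_).2 (MemLp.zero (ε := ℂ))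
        filter_upwards [Lp.coeFn_zero ℂ 2 (volume : Measure E3)] with x hx
        simp [hx]
      add_mem' := fun {f g} hf hg => (memLp_congr_ae (mul_add_ae m f g)).2 (hf.add hg)
      smul_mem' := fun c f hf => (memLp_congr_ae (mul_smul_ae m c f)).2 (hf.const_smul c) }
  toFun :=
    { toFun := fun f => MemLp.toLp _ f.2
      map_add' := fun f g => by
        rw [← MemLp.toLp_add]
        exact MemLp.toLp_congr _ _ (mul_add_ae m f g)
      map_smul' := fun c f => by
        rw [RingHom.id_apply, ← MemLp.toLp_const_smul]
        exact MemLp.toLp_congr _ _ (mul_smul_ae m c f) }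

theorem memLp_mul_bounded {m : E3 → ℂ} (hm : Measurable m) (hb : ∀ x, ‖m x‖ ≤ 1) (f : L2) :
    MemLp (fun x => m x * f x) 2 volume := by
  refine (Lp.memLp f).mono (hm.aestronglyMeasurable.mul (Lp.memLp f).1) ?_
  filter_upwards with x
  rw [norm_mul]
  exact mul_le_of_le_one_left (norm_nonneg _) (hb x)

/-- Multiplication by a measurable function `m` with `|m| ≤ 1`, as a bounded operator on `L²`. -/
def mulCLM (m : E3 → ℂ) (hm : Measurable m) (hb : ∀ x, ‖m x‖ ≤ 1) : L2 →L[ℂ] L2 :=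
  LinearMap.mkContinuous
    { toFun := fun f => MemLp.toLp _ (memLp_mul_bounded hm hb f)
      map_add' := fun f g => by
        rw [← MemLp.toLp_add]
        exact MemLp.toLp_congr _ _ (mul_add_ae m f g)
      map_smul' := fun c f => by
        rw [RingHom.id_apply, ← MemLp.toLp_const_smul]
        exact MemLp.toLp_congr _ _ (mul_smul_ae m c f) }
    1 (fun f => by
      rw [one_mul]
      refine Lp.norm_le_norm_of_ae_le ?_
      filter_upwards [MemLp.coeFn_toLp (memLp_mul_bounded hm hb f)] with x hx
      rw [LinearMap.coe_mk, AddHom.coe_mk, hx, norm_mul]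
      exact mul_le_of_le_one_left (norm_nonneg _) (hb x))

/-- The Fourier transform of `L²(ℝ³)`, `𝓕 f(ξ) = ∫ e^{-2πi x·ξ} f(x) dx`, as a unitary map. -/
abbrev fourierL2 : L2 ≃ₗᵢ[ℂ] L2 := Lp.fourierTransformₗᵢ E3 ℂ

/-- The Fourier multiplier `𝓕⁻¹ m 𝓕` with its maximal domain `{f ∈ L² : m 𝓕 f ∈ L²}`, as an
unbounded operator on `L²`. -/
def fourierMulOp (m : E3 → ℂ) : L2 →ₗ.[ℂ] L2 where
  domain := (mulOp m).domain.comap (fourierL2.toLinearEquiv : L2 →ₗ[ℂ] L2)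
  toFun :=
    (fourierL2.symm.toLinearEquiv : L2 →ₗ[ℂ] L2) ∘ₗ (mulOp m).toFun ∘ₗ
      (fourierL2.toLinearEquiv : L2 →ₗ[ℂ] L2).restrict (fun _ hf => hf)

/-- The Japanese bracket `⟨x⟩ = (1 + |x|²)^{1/2}`. -/
def bracket (x : E3) : ℝ := Real.sqrt (1 + ‖x‖ ^ 2)

/-- The operator of multiplication by `⟨x⟩^σ`. -/
def positionWeight (σ : ℝ) : L2 →ₗ.[ℂ] L2 :=
  mulOp fun x => ((bracket x ^ σ : ℝ) : ℂ)

/-- The operator `⟨ħ∇⟩^σ = (1 - ħ²Δ)^{σ/2}`. With the normalisation of the Fourier transform used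
here, `-iħ∇` is multiplication by `2πħξ` on the Fourier side. -/
def momentumWeight (ħ σ : ℝ) : L2 →ₗ.[ℂ] L2 :=
  fourierMulOp fun ξ => ((bracket ((2 * Real.pi * ħ) • ξ) ^ σ : ℝ) : ℂ)

/-- The symbol `e^{-itħ|2πξ|²/2}` of the free Schrödinger flow. -/
def freeSymbol (ħ t : ℝ) (ξ : E3) : ℂ :=
  Complex.exp (((-(t * ħ * (2 * Real.pi * ‖ξ‖) ^ 2 / 2) : ℝ) : ℂ) * Complex.I)

theorem measurable_freeSymbol (ħ t : ℝ) : Measurable (freeSymbol ħ t) := by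
  unfold freeSymbol
  fun_prop

theorem norm_freeSymbol_le (ħ t : ℝ) (ξ : E3) : ‖freeSymbol ħ t ξ‖ ≤ 1 :=
  (Complex.norm_exp_ofReal_mul_I _).le

/-- The free Schrödinger propagator `𝒰^ħ(t) = e^{itħΔ/2}` on `L²(ℝ³)`. -/
def freeFlow (ħ t : ℝ) : L2 →L[ℂ] L2 :=
  (fourierL2.symm.toContinuousLinearEquiv : L2 →L[ℂ] L2) ∘L
    mulCLM (freeSymbol ħ t) (measurable_freeSymbol ħ t) (norm_freeSymbol_le ħ t) ∘L
      (fourierL2.toContinuousLinearEquiv : L2 →L[ℂ] L2)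

/-- The evolved operator `𝒰^ħ(t) γ 𝒰^ħ(t)*`. -/
def evolve (ħ t : ℝ) (γ : L2 →L[ℂ] L2) : L2 →L[ℂ] L2 :=
  freeFlow ħ t ∘L γ ∘L ContinuousLinearMap.adjoint (freeFlow ħ t)

theorem norm_indicator_one_le (S : Set E3) (x : E3) :
    ‖S.indicator (fun _ => (1 : ℂ)) x‖ ≤ 1 := by
  by_cases hx : x ∈ S <;> simp [hx]

/-- Multiplication by the indicator function of the measurable set `S`. -/
def cutoff (S : Set E3) (hS : MeasurableSet S) : L2 →L[ℂ] L2 :=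
  mulCLM (S.indicator fun _ => 1) (measurable_const.indicator hS) (norm_indicator_one_le S)

/-- `ρ` is the semiclassically rescaled density `ρ^ħ_A(x) = (2πħ)³ A(x,x)` of the operator `A`:
`A` is locally trace class and `ρ` is the (almost everywhere unique) locally integrable function
with `∫_S ρ = (2πħ)³ Tr(1_S A 1_S)` for all bounded measurable sets `S`. -/
def IsDensity (ħ : ℝ) (A : L2 →L[ℂ] L2) (ρ : E3 → ℂ) : Prop :=
  LocallyIntegrable ρ volume ∧
  ∀ (S : Set E3) (hS : MeasurableSet S), Bornology.IsBounded S →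
    IsTraceClass (cutoff S hS ∘L A ∘L cutoff S hS) ∧
    ∫ x in S, ρ x = (((2 * Real.pi * ħ) ^ 3 : ℝ) : ℂ) * trace (cutoff S hS ∘L A ∘L cutoff S hS)

end Semiclassical

end

/-! Let `R` be the bounded inverse of the weight. If `B` is the sandwiched operator, then `γ₀ = R B
R`, and the evolved operator is `(TG) B (TG)*`. For the position weight `T = 𝒰(t)⟨x⟩^{-σ}` and `G =
1`. The momentum weight commutes with the flow, so there `T = 𝓕⁻¹⟨2πħξ⟩^{-σ}` and `G` is the
contraction "symbol times `𝓕`". Polar decomposition `B = U|B|` writes the operator as `X Y*` with `X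
= TGU|B|^{1/2}` and `Y = TG|B|^{1/2}`. Its density is at most the sum of the densities of `XX*` and
`YY*`, so it suffices to bound, for every contraction `G'`, the density of
`(TG'|B|^{1/2})(TG'|B|^{1/2})*` in `L^r`.

If `T` has rows `K x` in `L²`, this density at `x` is `⟨v,|B|v⟩` with `v = G'* (K x)`. Jensen's
inequality for the spectral measure bounds its `r`-th power by `‖v‖^{2(r-1)} ⟨v,|B|^r v⟩`. The last
factor integrates to a Hilbert–Schmidt norm, at most `‖T‖² Tr|B|^r`. The result
(`eLpNorm_localDensity_le`) carries the factor `(sup‖K x‖²)^{1/r'} (‖T‖²)^{1/r}`, without complex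
interpolation.

The rows of `T` itself are controlled in `L²` only when `σ > 3/2`. To reach `σ > 3/(2r')` the weight
is cut into dyadic shells (`eLpNorm_localDensity_invWeight_le`). On the `k`-th shell `‖T‖ ≲ 2^{-σk}`
and `‖K x‖² ≲ κ² 2^{(3-2σ)k}/λ³`, where `κ` bounds the kernel of `𝓕⁻¹` or `𝒰(t)` and `λ` is the
scale in the weight. The factor is then a multiple of `2^{(3/r'-2σ)k}`, which is summable. A
weighted Cauchy–Schwarz inequality reassembles the shells.

Since `κ = 1`, `λ = 2πħ` in one case and `κ = (2πħ|t|)^{-3/2}`, `λ = 1` in the other,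
`(κ²/λ³)^{1/r'}` supplies exactly the missing powers of `ħ` and `|t|`. -/

noncomputable section

namespace Semiclassical

/-! ### Hilbert–Schmidt sums, spectral Jensen inequality, polar decomposition, traces of products.
-/

section Hilbert

variable {H : Type*} [NormedAddCommGroup H] [InnerProductSpace ℂ H]

open ContinuousLinearMap (adjoint adjoint_inner_left adjoint_inner_right)

theorem ofReal_norm_sq {E : Type*} [SeminormedAddCommGroup E] (v : E) :
    ENNReal.ofReal (‖v‖ ^ 2) = ‖v‖ₑ ^ 2 := by
  rw [ENNReal.ofReal_pow (norm_nonneg _), ofReal_norm]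

/-- Parseval's identity. -/
theorem tsum_enorm_inner_sq {ι : Type*} (b : HilbertBasis ι ℂ H) (v : H) :
    ∑' i, ‖⟪b i, v⟫_ℂ‖ₑ ^ 2 = ‖v‖ₑ ^ 2 := by
  have h := b.hasSum_inner_mul_inner v v
  have e1 : (fun i => ⟪v, b i⟫_ℂ * ⟪b i, v⟫_ℂ) = fun i => ((‖⟪b i, v⟫_ℂ‖ ^ 2 : ℝ) : ℂ) := by
    funext i
    rw [← inner_conj_symm v (b i), RCLike.conj_mul]
    simp
  have e2 : ⟪v, v⟫_ℂ = ((‖v‖ ^ 2 : ℝ) : ℂ) := by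
    rw [inner_self_eq_norm_sq_to_K]
    simp
  rw [e1, e2] at h
  have h' : HasSum (fun i => ‖⟪b i, v⟫_ℂ‖ ^ 2) (‖v‖ ^ 2) := Complex.hasSum_ofReal.1 h
  simp_rw [← ofReal_norm_sq]
  rw [← ENNReal.ofReal_tsum_of_nonneg (fun _ => by positivity) h'.summable, h'.tsum_eq]

variable [CompleteSpace H]

/-- The square `∑ᵢ ‖X eᵢ‖²` of the Hilbert–Schmidt norm. -/
def hsSq (X : H →L[ℂ] H) : ℝ≥0∞ := ∑' i, ‖X (chosenBasis H i)‖ₑ ^ 2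

theorem hsSq_adjoint (X : H →L[ℂ] H) : hsSq (adjoint X) = hsSq X := by
  unfold hsSq
  simp_rw [← tsum_enorm_inner_sq (chosenBasis H)]
  rw [ENNReal.tsum_comm]
  refine tsum_congr fun i => tsum_congr fun j => ?_
  rw [adjoint_inner_right, ← inner_conj_symm, RCLike.enorm_conj]

theorem hsSq_comp_le (X Y : H →L[ℂ] H) : hsSq (X ∘L Y) ≤ ‖X‖ₑ ^ 2 * hsSq Y := by
  unfold hsSq
  rw [← ENNReal.tsum_mul_left]
  refine ENNReal.tsum_le_tsum fun i => ?_
  rw [← mul_pow]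
  gcongr
  exact X.le_opENorm _

theorem hsSq_comp_le' (X Y : H →L[ℂ] H) : hsSq (X ∘L Y) ≤ ‖Y‖ₑ ^ 2 * hsSq X := by
  rw [← hsSq_adjoint, ContinuousLinearMap.adjoint_comp, ← hsSq_adjoint X]
  refine (hsSq_comp_le _ _).trans_eq ?_
  rw [← ofReal_norm, LinearIsometryEquiv.norm_map, ofReal_norm]

theorem norm_sqrt_apply_sq {Q : H →L[ℂ] H} (hQ : 0 ≤ Q) (v : H) :
    ‖CFC.sqrt Q v‖ ^ 2 = (⟪v, Q v⟫_ℂ).re := by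
  have hs : IsSelfAdjoint (CFC.sqrt Q) := (CFC.sqrt_nonneg Q).isSelfAdjoint
  rw [← ContinuousLinearMap.isSelfAdjoint_iff'.mp hs]
  nth_rewrite 2 [← CFC.sqrt_mul_sqrt_self Q hQ]
  rw [mul_apply_eq_comp, ← adjoint_inner_left,
    ContinuousLinearMap.isSelfAdjoint_iff'.mp hs, inner_self_eq_norm_sq_to_K]
  norm_cast

theorem posTrace_eq_hsSq_sqrt {Q : H →L[ℂ] H} (hQ : 0 ≤ Q) :
    posTrace Q = hsSq (CFC.sqrt Q) := by
  unfold posTrace hsSq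
  refine tsum_congr fun i => ?_
  rw [← norm_sqrt_apply_sq hQ, ofReal_norm_sq]

/-- By convexity `x ↦ x^s` lies above its tangent at `l`; Young's inequality with exponents `s` and
`s/(s-1)` gives this directly. -/
theorem rpow_tangent {s l x : ℝ} (hs : 1 ≤ s) (hl : 0 ≤ l) (hx : 0 ≤ x) :
    s * l ^ (s - 1) * x ≤ x ^ s + (s - 1) * l ^ s := by
  rcases hs.eq_or_lt with rfl | hs
  · simp
  have hpq := Real.HolderConjugate.conjExponent hs
  have h := Real.young_inequality_of_nonneg hx (Real.rpow_nonneg hl (s - 1)) hpq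
  have hs0 : (0 : ℝ) < s := by linarith
  have hs1 : s - 1 ≠ 0 := by linarith
  rw [← Real.rpow_mul hl, Real.conjExponent, mul_div_cancel₀ _ hs1] at h
  have h2 := mul_le_mul_of_nonneg_left h hs0.le
  have h3 : s * (x ^ s / s + l ^ s / (s / (s - 1))) = x ^ s + (s - 1) * l ^ s := by
    field_simp
  linarith

/-- Jensen's inequality for the spectral measure of a non-negative operator. -/
theorem inner_rpow_le {Q : H →L[ℂ] H} (hQ : 0 ≤ Q) {s : ℝ} (hs : 1 ≤ s) (v : H) :
    ((⟪v, Q v⟫_ℂ).re) ^ s ≤ (‖v‖ ^ 2) ^ (s - 1) * (⟪v, (Q ^ s) v⟫_ℂ).re := by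
  have hs0 : 0 < s := by linarith
  rcases eq_or_ne v 0 with rfl | hv
  · simp [Real.zero_rpow hs0.ne']
  have hn : 0 < ‖v‖ ^ 2 := by positivity
  set a := (⟪v, Q v⟫_ℂ).re with ha
  have ha0 : 0 ≤ a := by rw [ha, ← norm_sqrt_apply_sq hQ]; positivity
  -- The tangent is taken at the mean of the normalised spectral measure of `v`, the point at which
  -- Jensen's inequality comes out.
  set l := a / ‖v‖ ^ 2 with hl
  have hl0 : 0 ≤ l := by positivity
  have key : (s * l ^ (s - 1)) • Q ≤ Q ^ s + ((s - 1) * l ^ s) • (1 : H →L[ℂ] H) := by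
    have hsa : IsSelfAdjoint Q := hQ.isSelfAdjoint
    have hc : Continuous fun x : ℝ => x ^ s := Real.continuous_rpow_const hs0.le
    have e1 : cfc (fun x : ℝ => s * l ^ (s - 1) * x) Q = (s * l ^ (s - 1)) • Q := by
      rw [cfc_const_mul_id _ Q hsa]
    have e2 : cfc (fun x : ℝ => x ^ s + (s - 1) * l ^ s) Q =
        Q ^ s + ((s - 1) * l ^ s) • (1 : H →L[ℂ] H) := by
      rw [cfc_add_const _ _ Q hc.continuousOn, CFC.rpow_eq_cfc_real, Algebra.algebraMap_eq_smul_one]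
    rw [← e1, ← e2]
    refine cfc_mono (fun x hx => rpow_tangent hs hl0 ?_) (by fun_prop)
      (hc.continuousOn.add continuousOn_const)
    exact spectrum_nonneg_of_nonneg hQ hx
  have h := (ContinuousLinearMap.le_def _ _).1 key |>.re_inner_nonneg_right v
  have h2 : s * l ^ (s - 1) * a ≤ (⟪v, (Q ^ s) v⟫_ℂ).re + (s - 1) * l ^ s * ‖v‖ ^ 2 := by
    have e : RCLike.re ⟪v, (Q ^ s + ((s - 1) * l ^ s) • (1 : H →L[ℂ] H) -
        (s * l ^ (s - 1)) • Q) v⟫_ℂ = (⟪v, (Q ^ s) v⟫_ℂ).re + (s - 1) * l ^ s * ‖v‖ ^ 2 -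
          s * l ^ (s - 1) * a := by
      simp only [sub_apply, add_apply,
        smul_apply, one_apply_eq_self, inner_sub_right,
        inner_add_right, ← Complex.coe_smul, inner_smul_right, RCLike.re_to_complex,
        Complex.sub_re, Complex.add_re, Complex.re_ofReal_mul, ha]
      congr 3
      rw [inner_self_eq_norm_sq_to_K]
      norm_cast
    rw [e] at h
    linarith
  have h3 : l ^ (s - 1) * a = l ^ s * ‖v‖ ^ 2 := by
    have : a = l * ‖v‖ ^ 2 := by rw [hl]; field_simp
    rw [this, ← mul_assoc, ← Real.rpow_add_one' hl0 (by linarith)]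
    congr 2; ring
  have h4 : l ^ s * ‖v‖ ^ 2 ≤ (⟪v, (Q ^ s) v⟫_ℂ).re := by
    rw [mul_assoc, h3] at h2; linarith
  calc a ^ s = (‖v‖ ^ 2) ^ (s - 1) * (l ^ s * ‖v‖ ^ 2) := by
        have : a = l * ‖v‖ ^ 2 := by rw [hl]; field_simp
        rw [this, Real.mul_rpow hl0 hn.le, mul_left_comm, ← Real.rpow_add_one hn.ne',
          sub_add_cancel]
    _ ≤ _ := by gcongr

theorem norm_abs_apply (B : H →L[ℂ] H) (x : H) : ‖CFC.abs B x‖ = ‖B x‖ := by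
  have hs : IsSelfAdjoint (CFC.abs B) := (CFC.abs_nonneg B).isSelfAdjoint
  have h : ⟪CFC.abs B x, CFC.abs B x⟫_ℂ = ⟪B x, B x⟫_ℂ := by
    rw [← adjoint_inner_right B, ← adjoint_inner_right (CFC.abs B),
      ContinuousLinearMap.isSelfAdjoint_iff'.mp hs, ← mul_apply_eq_comp,
      CFC.abs_mul_abs]
    rfl
  rw [inner_self_eq_norm_sq_to_K, inner_self_eq_norm_sq_to_K] at h
  have h' : ‖CFC.abs B x‖ ^ 2 = ‖B x‖ ^ 2 := by exact_mod_cast h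
  exact (pow_left_inj₀ (norm_nonneg _) (norm_nonneg _) two_ne_zero).1 h'

/-- The polar decomposition `B = U |B|` with a contraction `U` such that `U* B = |B|`. -/
theorem exists_polar (B : H →L[ℂ] H) :
    ∃ U : H →L[ℂ] H, ‖U‖ ≤ 1 ∧ U ∘L CFC.abs B = B ∧ adjoint U ∘L B = CFC.abs B := by
  set K : Submodule ℂ H := (LinearMap.range (CFC.abs B).toLinearMap).topologicalClosure with hK
  have hmem : ∀ x, CFC.abs B x ∈ K := fun x =>
    Submodule.le_topologicalClosure _ (LinearMap.mem_range_self _ x)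
  let e : H →ₗ[ℂ] K := (CFC.abs B).toLinearMap.codRestrict K hmem
  have hd : DenseRange e := by
    intro y
    rw [Metric.mem_closure_iff]
    intro ε hε
    have hy : (y : H) ∈ closure (LinearMap.range (CFC.abs B).toLinearMap : Set H) := y.2
    obtain ⟨_, ⟨x, rfl⟩, hx⟩ := Metric.mem_closure_iff.1 hy ε hε
    exact ⟨e x, ⟨x, rfl⟩, hx⟩
  have hb : ∀ x, ‖(B : H →ₗ[ℂ] H) x‖ ≤ 1 * ‖e x‖ := fun x => by
    rw [one_mul]
    exact (norm_abs_apply B x).ge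
  have : CompleteSpace K := (Submodule.isClosed_topologicalClosure _).completeSpace_coe
  let U : H →L[ℂ] H := (B : H →ₗ[ℂ] H).extendOfNorm e ∘L K.orthogonalProjectionOnto
  have hU : ‖U‖ ≤ 1 := by
    refine (ContinuousLinearMap.opNorm_comp_le _ _).trans ?_
    exact mul_le_one₀ (LinearMap.opNorm_extendOfNorm_le hd zero_le_one hb) (norm_nonneg _)
      (Submodule.orthogonalProjectionOnto_norm_le K)
  have hUB : ∀ x, U (CFC.abs B x) = B x := fun x => by
    have h1 : K.orthogonalProjectionOnto (CFC.abs B x) = e x :=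
      Submodule.orthogonalProjectionOnto_mem_subspace_eq_self (e x)
    have h2 := LinearMap.extendOfNorm_eq (f := (B : H →ₗ[ℂ] H)) hd ⟨1, hb⟩ x
    simp only [U, ContinuousLinearMap.comp_apply, h1]
    exact h2
  refine ⟨U, hU, ContinuousLinearMap.ext hUB, ContinuousLinearMap.ext fun x => ?_⟩
  have h1 : RCLike.re ⟪adjoint U (B x), CFC.abs B x⟫_ℂ = ‖B x‖ ^ 2 := by
    rw [adjoint_inner_left, hUB, inner_self_eq_norm_sq_to_K]
    norm_cast
  have h2 : ‖adjoint U (B x)‖ ≤ ‖B x‖ := by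
    refine ((adjoint U).le_opNorm _).trans ?_
    rw [LinearIsometryEquiv.norm_map]
    exact mul_le_of_le_one_left (norm_nonneg _) hU
  -- Expanding `‖U*Bx - |B|x‖²`, the cross term equals `‖Bx‖²` and both squares are at most `‖Bx‖²`,
  -- so the difference vanishes.
  have h3 := @norm_sub_sq ℂ H _ _ _ (adjoint U (B x)) (CFC.abs B x)
  rw [h1, norm_abs_apply] at h3
  have h4 : ‖adjoint U (B x)‖ ^ 2 ≤ ‖B x‖ ^ 2 := by gcongr
  have h5 : ‖adjoint U (B x) - CFC.abs B x‖ ^ 2 ≤ 0 := by linarith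
  have h6 : ‖adjoint U (B x) - CFC.abs B x‖ = 0 := by
    exact pow_eq_zero_iff two_ne_zero |>.1 (le_antisymm h5 (by positivity))
  exact sub_eq_zero.1 (norm_eq_zero.1 h6)

theorem abs_rpow_nonneg (s : ℝ) (B : H →L[ℂ] H) : 0 ≤ CFC.abs B ^ s :=
  CFC.rpow_nonneg (a := CFC.abs B) (y := s)

/-- The operator `|B|^{s/2}`. -/
def absRoot (s : ℝ) (B : H →L[ℂ] H) : H →L[ℂ] H := CFC.sqrt (CFC.abs B ^ s)

theorem adjoint_absRoot (s : ℝ) (B : H →L[ℂ] H) : adjoint (absRoot s B) = absRoot s B :=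
  ContinuousLinearMap.isSelfAdjoint_iff'.1 (CFC.sqrt_nonneg _).isSelfAdjoint

theorem norm_absRoot_one_sq_le (B : H →L[ℂ] H) (v : H) : ‖absRoot 1 B v‖ ^ 2 ≤ ‖v‖ * ‖B v‖ := by
  rw [absRoot, norm_sqrt_apply_sq (abs_rpow_nonneg _ _), CFC.rpow_one _ (CFC.abs_nonneg _),
    ← norm_abs_apply]
  exact (Complex.re_le_norm _).trans (norm_inner_le_norm _ _)

theorem norm_absRoot_one_sq_rpow_le (B : H →L[ℂ] H) {s : ℝ} (hs : 1 ≤ s) (v : H) :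
    (‖absRoot 1 B v‖ ^ 2) ^ s ≤ (‖v‖ ^ 2) ^ (s - 1) * ‖absRoot s B v‖ ^ 2 := by
  rw [absRoot, absRoot, norm_sqrt_apply_sq (abs_rpow_nonneg _ _),
    norm_sqrt_apply_sq (abs_rpow_nonneg _ _), CFC.rpow_one _ (CFC.abs_nonneg _)]
  exact inner_rpow_le (CFC.abs_nonneg B) hs v

theorem schattenNorm_of_ne_top {r : ℝ≥0∞} (hr : r ≠ ∞) (B : H →L[ℂ] H) :
    schattenNorm r B = (hsSq (absRoot r.toReal B)) ^ (1 / r.toReal) := by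
  rw [schattenNorm, if_neg hr, posTrace_eq_hsSq_sqrt (abs_rpow_nonneg _ _), absRoot]

theorem exists_comp_absRoot_eq (B : H →L[ℂ] H) :
    ∃ U : H →L[ℂ] H, ‖U‖ ≤ 1 ∧ (U ∘L absRoot 1 B) ∘L absRoot 1 B = B := by
  obtain ⟨U, hU, h, -⟩ := exists_polar B
  refine ⟨U, hU, ?_⟩
  have e : absRoot 1 B ∘L absRoot 1 B = CFC.abs B := by
    rw [absRoot, CFC.rpow_one _ (CFC.abs_nonneg _)]
    exact CFC.sqrt_mul_sqrt_self _ (CFC.abs_nonneg B)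
  rw [ContinuousLinearMap.comp_assoc, e, h]

/-- Splits `B = (U|B|^{1/2})|B|^{1/2}` between the two sides, so that a non-selfadjoint `B` is
handled by two positive densities. -/
theorem conj_eq_comp_adjoint (T G : H →L[ℂ] H) {U B : H →L[ℂ] H}
    (hUB : (U ∘L absRoot 1 B) ∘L absRoot 1 B = B) :
    (T ∘L G) ∘L B ∘L adjoint (T ∘L G) =
      (T ∘L (G ∘L U) ∘L absRoot 1 B) ∘L adjoint (T ∘L G ∘L absRoot 1 B) := by
  nth_rewrite 1 [← hUB]
  simp only [ContinuousLinearMap.adjoint_comp, adjoint_absRoot, ContinuousLinearMap.comp_assoc]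

theorem ofReal_mul_le_sq_add_sq (a b : ℝ) :
    ENNReal.ofReal (a * b) ≤ ENNReal.ofReal (a ^ 2) + ENNReal.ofReal (b ^ 2) := by
  rw [← ENNReal.ofReal_add (by positivity) (by positivity)]
  exact ENNReal.ofReal_le_ofReal (by nlinarith [sq_nonneg (a - b)])

/-- With `U` from the polar decomposition of `XY*`, the diagonal entries of `|XY*| = U*XY*` are
`⟨X*U e, Y* e⟩`, dominated by two Hilbert–Schmidt sums. -/
theorem isTraceClass_comp_adjoint {X Y : H →L[ℂ] H} (hX : hsSq X < ∞) (hY : hsSq Y < ∞) :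
    IsTraceClass (X ∘L adjoint Y) := by
  obtain ⟨U, -, -, hU⟩ := exists_polar (X ∘L adjoint Y)
  unfold IsTraceClass schattenNorm
  rw [if_neg ENNReal.one_ne_top]
  simp only [ENNReal.toReal_one, div_one, ENNReal.rpow_one]
  rw [CFC.rpow_one _ (CFC.abs_nonneg _), ← hU]
  have hX' : hsSq (adjoint X ∘L U) < ∞ := by
    refine (hsSq_comp_le' _ _).trans_lt (ENNReal.mul_lt_top ?_ ?_)
    · exact ENNReal.pow_lt_top enorm_lt_top
    · rwa [hsSq_adjoint]
  rw [← hsSq_adjoint] at hY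
  refine lt_of_le_of_lt ?_ (ENNReal.add_lt_top.2 ⟨hX', hY⟩)
  unfold posTrace hsSq
  rw [← ENNReal.tsum_add]
  refine ENNReal.tsum_le_tsum fun i => ?_
  rw [← ofReal_norm_sq, ← ofReal_norm_sq]
  refine le_trans (ENNReal.ofReal_le_ofReal ?_)
    (ofReal_mul_le_sq_add_sq _ _)
  simp only [ContinuousLinearMap.comp_apply]
  rw [adjoint_inner_right, ← adjoint_inner_left X]
  exact (Complex.re_le_norm _).trans (norm_inner_le_norm _ _)

/-- Cyclicity of the trace: both sides are iterated sums of one double series, absolutely convergent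
by Parseval. -/
theorem trace_comp_adjoint {X Y : H →L[ℂ] H} (hX : hsSq X < ∞) (hY : hsSq Y < ∞) :
    trace (X ∘L adjoint Y) = ∑' j, ⟪Y (chosenBasis H j), X (chosenBasis H j)⟫_ℂ := by
  set b := chosenBasis H
  have hsum : Summable fun p : basisIndex H × basisIndex H =>
      ⟪Y (b p.2), b p.1⟫_ℂ * ⟪b p.1, X (b p.2)⟫_ℂ := by
    refine Summable.of_norm ?_
    have hfin : ∑' p : basisIndex H × basisIndex H,
        ENNReal.ofReal ‖⟪Y (b p.2), b p.1⟫_ℂ * ⟪b p.1, X (b p.2)⟫_ℂ‖ ≠ ∞ := by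
      refine ne_top_of_le_ne_top (ENNReal.add_lt_top.2 ⟨hY, hX⟩).ne ?_
      unfold hsSq
      rw [← ENNReal.tsum_add, ENNReal.tsum_prod', ENNReal.tsum_comm]
      refine ENNReal.tsum_le_tsum fun j => ?_
      rw [← tsum_enorm_inner_sq b, ← tsum_enorm_inner_sq b, ← ENNReal.tsum_add]
      refine ENNReal.tsum_le_tsum fun i => ?_
      rw [norm_mul, ← ofReal_norm_sq, ← ofReal_norm_sq, norm_inner_symm]
      exact ofReal_mul_le_sq_add_sq _ _
    have := ENNReal.summable_toReal hfin
    simpa using this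
  have h1 : ∀ i, ⟪b i, (X ∘L adjoint Y) (b i)⟫_ℂ =
      ∑' j, ⟪Y (b j), b i⟫_ℂ * ⟪b i, X (b j)⟫_ℂ := fun i => by
    rw [ContinuousLinearMap.comp_apply, ← adjoint_inner_left X,
      ← b.tsum_inner_mul_inner]
    refine tsum_congr fun j => ?_
    rw [adjoint_inner_left, adjoint_inner_right, mul_comm]
  have h2 : ∀ j, ⟪Y (b j), X (b j)⟫_ℂ = ∑' i, ⟪Y (b j), b i⟫_ℂ * ⟪b i, X (b j)⟫_ℂ :=
    fun j => (b.tsum_inner_mul_inner _ _).symm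
  unfold trace
  simp_rw [h2]
  change ∑' i, ⟪b i, (X ∘L adjoint Y) (b i)⟫_ℂ = _
  simp_rw [h1]
  exact Summable.tsum_comm (f := fun i j => ⟪Y (b j), b i⟫_ℂ * ⟪b i, X (b j)⟫_ℂ) hsum |>.symm

end Hilbert

/-! ### Densities of products `XY*` on `L²(ℝ³)`. -/

section Density

open ContinuousLinearMap (adjoint adjoint_inner_left adjoint_inner_right)

/-- Orthonormal vectors lie at distance `√2`, so the balls of radius `1/2` around them are disjoint
in a separable space. Countability permits almost-everywhere statements for all basis vectors at
once and termwise integration. -/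
instance countable_basisIndex : Countable (basisIndex L2) := by
  have : Fact ((2 : ℝ≥0∞) ≠ ∞) := ⟨ENNReal.ofNat_ne_top⟩
  have : SecondCountableTopology L2 := Lp.SecondCountableTopology
  refine Pairwise.countable_of_isOpen_disjoint
    (s := fun i => Metric.ball (chosenBasis L2 i) (1 / 2)) (fun i j hij => ?_)
    (fun i => Metric.isOpen_ball) (fun i => Metric.nonempty_ball.2 (by norm_num))
  refine Metric.ball_disjoint_ball ?_
  have ho := (chosenBasis L2).orthonormal
  have h := @norm_sub_sq ℂ L2 _ _ _ (chosenBasis L2 i) (chosenBasis L2 j)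
  rw [ho.1, ho.1, ho.2 hij] at h
  rw [dist_eq_norm]
  norm_num at h ⊢
  nlinarith [norm_nonneg (chosenBasis L2 i - chosenBasis L2 j)]

theorem mulCLM_ae (m : E3 → ℂ) (hm : Measurable m) (hb : ∀ x, ‖m x‖ ≤ 1) (f : L2) :
    mulCLM m hm hb f =ᵐ[volume] fun x => m x * f x :=
  MemLp.coeFn_toLp (memLp_mul_bounded hm hb f)

theorem cutoff_ae (S : Set E3) (hS : MeasurableSet S) (f : L2) :
    cutoff S hS f =ᵐ[volume] S.indicator f := by
  filter_upwards [mulCLM_ae _ (measurable_const.indicator hS) (norm_indicator_one_le S) f] with x hx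
  rw [cutoff, hx]
  by_cases h : x ∈ S <;> simp [h]

theorem enorm_sq_eq_lintegral (f : L2) : ‖f‖ₑ ^ 2 = ∫⁻ x, ‖f x‖ₑ ^ 2 := by
  have h := eLpNorm_nnreal_pow_eq_lintegral (f := f) (μ := (volume : Measure E3))
    (p := 2) two_ne_zero
  rw [Lp.enorm_def]
  simpa using h

theorem enorm_cutoff_sq (S : Set E3) (hS : MeasurableSet S) (f : L2) :
    ‖cutoff S hS f‖ₑ ^ 2 = ∫⁻ x in S, ‖f x‖ₑ ^ 2 := by
  rw [enorm_sq_eq_lintegral, ← lintegral_indicator hS]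
  refine lintegral_congr_ae ?_
  filter_upwards [cutoff_ae S hS f] with x hx
  rw [hx]
  by_cases h : x ∈ S <;> simp [h]

theorem inner_cutoff (S : Set E3) (hS : MeasurableSet S) (f g : L2) :
    ⟪cutoff S hS f, cutoff S hS g⟫_ℂ = ∫ x in S, ⟪f x, g x⟫_ℂ := by
  rw [L2.inner_def, ← integral_indicator hS]
  refine integral_congr_ae ?_
  filter_upwards [cutoff_ae S hS f, cutoff_ae S hS g] with x hx hy
  rw [hx, hy]
  by_cases h : x ∈ S <;> simp [h]

theorem adjoint_cutoff (S : Set E3) (hS : MeasurableSet S) :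
    adjoint (cutoff S hS) = cutoff S hS := by
  symm
  rw [ContinuousLinearMap.eq_adjoint_iff]
  intro f g
  rw [L2.inner_def, L2.inner_def]
  refine integral_congr_ae ?_
  filter_upwards [cutoff_ae S hS f, cutoff_ae S hS g] with x hx hy
  rw [hx, hy]
  by_cases h : x ∈ S <;> simp [h]

/-- The (unscaled) density `∑ᵢ |X eᵢ(x)|²` of `X X*`. -/
def localDensity (X : L2 →L[ℂ] L2) (x : E3) : ℝ≥0∞ :=
  ∑' i, ‖X (chosenBasis L2 i) x‖ₑ ^ 2

/-- The (unscaled) density `∑ᵢ (X eᵢ)(x) conj((Y eᵢ)(x))` of `X Y*`. -/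
def pairDensity (X Y : L2 →L[ℂ] L2) (x : E3) : ℂ :=
  ∑' i, ⟪Y (chosenBasis L2 i) x, X (chosenBasis L2 i) x⟫_ℂ

theorem measurable_coe (f : L2) : Measurable (f : E3 → ℂ) :=
  (Lp.stronglyMeasurable f).measurable

theorem measurable_localDensity (X : L2 →L[ℂ] L2) : Measurable (localDensity X) :=
  Measurable.tsum fun _ => (measurable_coe _).enorm.pow_const 2

theorem measurable_pairDensity (X Y : L2 →L[ℂ] L2) : Measurable (pairDensity X Y) :=
  Measurable.tsum fun _ => (measurable_coe _).inner (measurable_coe _)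

theorem setLIntegral_localDensity (X : L2 →L[ℂ] L2) (S : Set E3) (hS : MeasurableSet S) :
    ∫⁻ x in S, localDensity X x = hsSq (cutoff S hS ∘L X) := by
  unfold localDensity hsSq
  rw [lintegral_tsum fun _ => ((measurable_coe _).enorm.pow_const 2).aemeasurable]
  refine tsum_congr fun i => ?_
  rw [ContinuousLinearMap.comp_apply, enorm_cutoff_sq]

theorem lintegral_localDensity (X : L2 →L[ℂ] L2) : ∫⁻ x, localDensity X x = hsSq X := by
  unfold localDensity hsSq
  rw [lintegral_tsum fun _ => ((measurable_coe _).enorm.pow_const 2).aemeasurable]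
  exact tsum_congr fun i => (enorm_sq_eq_lintegral _).symm

theorem enorm_inner_le (z w : ℂ) : ‖⟪z, w⟫_ℂ‖ₑ ≤ ‖w‖ₑ ^ 2 + ‖z‖ₑ ^ 2 := by
  rw [← ofReal_norm, ← ofReal_norm_sq, ← ofReal_norm_sq, add_comm]
  exact (ENNReal.ofReal_le_ofReal (norm_inner_le_norm _ _)).trans (ofReal_mul_le_sq_add_sq _ _)

theorem tsum_enorm_inner_le (X Y : L2 →L[ℂ] L2) (x : E3) :
    ∑' i, ‖⟪Y (chosenBasis L2 i) x, X (chosenBasis L2 i) x⟫_ℂ‖ₑ ≤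
      localDensity X x + localDensity Y x := by
  unfold localDensity
  rw [← ENNReal.tsum_add]
  exact ENNReal.tsum_le_tsum fun i => enorm_inner_le _ _

theorem enorm_pairDensity_le (X Y : L2 →L[ℂ] L2) (x : E3) :
    ‖pairDensity X Y x‖ₑ ≤ localDensity X x + localDensity Y x :=
  enorm_tsum_le_tsum_enorm.trans (tsum_enorm_inner_le X Y x)

/-- The cut-off operator is `(1_S X)(1_S Y)*`, whose trace is a sum of integrals over `S`. The two
local bounds give the absolute convergence needed to exchange sum and integral. -/
theorem isDensity_pairDensity (ħ : ℝ) {X Y : L2 →L[ℂ] L2}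
    (hX : ∀ S : Set E3, MeasurableSet S → Bornology.IsBounded S → ∫⁻ x in S, localDensity X x < ∞)
    (hY : ∀ S : Set E3, MeasurableSet S → Bornology.IsBounded S → ∫⁻ x in S, localDensity Y x < ∞) :
    IsDensity ħ (X ∘L adjoint Y)
      (fun x => (((2 * Real.pi * ħ) ^ 3 : ℝ) : ℂ) * pairDensity X Y x) := by
  have hsum : ∀ S : Set E3, MeasurableSet S → Bornology.IsBounded S →
      ∑' i, ∫⁻ x in S, ‖⟪Y (chosenBasis L2 i) x, X (chosenBasis L2 i) x⟫_ℂ‖ₑ < ∞ := by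
    intro S hS hb
    rw [← lintegral_tsum fun _ =>
      ((measurable_coe _).inner (measurable_coe _)).enorm.aemeasurable]
    refine lt_of_le_of_lt (lintegral_mono fun x => tsum_enorm_inner_le X Y x) ?_
    rw [lintegral_add_left (measurable_localDensity X)]
    exact ENNReal.add_lt_top.2 ⟨hX S hS hb, hY S hS hb⟩
  constructor
  · refine LocallyIntegrable.smul (𝕜 := ℂ) ?_ _
    intro x
    refine ⟨Metric.ball x 1, Metric.ball_mem_nhds x one_pos,
      (measurable_pairDensity X Y).aestronglyMeasurable, ?_⟩
    refine lt_of_le_of_lt (lintegral_mono fun x => enorm_pairDensity_le X Y x) ?_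
    rw [lintegral_add_left (measurable_localDensity X)]
    exact ENNReal.add_lt_top.2 ⟨hX _ measurableSet_ball Metric.isBounded_ball,
      hY _ measurableSet_ball Metric.isBounded_ball⟩
  · intro S hS hb
    have hX' : hsSq (cutoff S hS ∘L X) < ∞ := by
      rw [← setLIntegral_localDensity]; exact hX S hS hb
    have hY' : hsSq (cutoff S hS ∘L Y) < ∞ := by
      rw [← setLIntegral_localDensity]; exact hY S hS hb
    have he : cutoff S hS ∘L (X ∘L adjoint Y) ∘L cutoff S hS =
        (cutoff S hS ∘L X) ∘L adjoint (cutoff S hS ∘L Y) := by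
      rw [ContinuousLinearMap.adjoint_comp, adjoint_cutoff]
      rfl
    rw [he]
    refine ⟨isTraceClass_comp_adjoint hX' hY', ?_⟩
    rw [trace_comp_adjoint hX' hY', integral_const_mul]
    congr 1
    have hint : ∀ i, IntegrableOn
        (fun x => ⟪Y (chosenBasis L2 i) x, X (chosenBasis L2 i) x⟫_ℂ) S := fun i =>
      ⟨((measurable_coe _).inner (measurable_coe _)).aestronglyMeasurable,
        (ENNReal.le_tsum i).trans_lt (hsum S hS hb)⟩
    have hs : Summable fun i =>
        ∫ x in S, ‖⟪Y (chosenBasis L2 i) x, X (chosenBasis L2 i) x⟫_ℂ‖ := by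
      have := ENNReal.summable_toReal (hsum S hS hb).ne
      refine this.congr fun i => ?_
      rw [integral_norm_eq_lintegral_enorm (hint i).1]
    refine (hasSum_integral_of_summable_integral_norm hint hs).tsum_eq.symm.trans ?_
    refine tsum_congr fun i => ?_
    rw [ContinuousLinearMap.comp_apply, ContinuousLinearMap.comp_apply, inner_cutoff]

/-- Integrals over compact sets determine a locally integrable function; hence a bound for one
density holds for all. -/
theorem IsDensity.ae_eq {ħ : ℝ} {A : L2 →L[ℂ] L2} {ρ ρ' : E3 → ℂ} (h : IsDensity ħ A ρ)
    (h' : IsDensity ħ A ρ') : ρ =ᵐ[volume] ρ' := by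
  have hz : ρ - ρ' =ᵐ[volume] 0 := by
    refine ae_eq_zero_of_forall_setIntegral_isCompact_eq_zero' (h.1.sub h'.1) fun S hS => ?_
    have hi := h.1.integrableOn_isCompact hS
    have hi' := h'.1.integrableOn_isCompact hS
    simp only [Pi.sub_apply]
    rw [integral_sub hi hi', (h.2 S hS.measurableSet hS.isBounded).2,
      (h'.2 S hS.measurableSet hS.isBounded).2, sub_self]
  filter_upwards [hz] with x hx using sub_eq_zero.1 hx

end Density

/-! ### Countable Minkowski and weighted Cauchy–Schwarz inequalities. -/

section LpTools

variable {α : Type*} [MeasurableSpace α] {μ : Measure α}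

/-- For finite `p`, the triangle inequality for partial sums passes to the limit by monotone
convergence. -/
theorem eLpNorm_tsum_le {f : ℕ → α → ℝ≥0∞} (hf : ∀ k, Measurable (f k)) {p : ℝ≥0∞} (hp : 1 ≤ p) :
    eLpNorm (fun x => ∑' k, f k x) p μ ≤ ∑' k, eLpNorm (f k) p μ := by
  have hp0 : p ≠ 0 := (zero_lt_one.trans_le hp).ne'
  rcases eq_or_ne p ∞ with rfl | hpt
  · simp only [eLpNorm_exponent_top]
    refine essSup_le_of_ae_le _ ?_
    have h : ∀ᵐ x ∂μ, ∀ k, ‖f k x‖ₑ ≤ eLpNormEssSup (f k) μ :=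
      ae_all_iff.2 fun k => ae_le_eLpNormEssSup
    filter_upwards [h] with x hx
    exact ENNReal.tsum_le_tsum hx
  · have hpos : 0 < p.toReal := ENNReal.toReal_pos hp0 hpt
    have hfin : ∀ n : ℕ, ∫⁻ x, (∑ k ∈ Finset.range n, f k x) ^ p.toReal ∂μ ≤
        (∑' k, eLpNorm (f k) p μ) ^ p.toReal := fun n => by
      have h := eLpNorm_sum_le (f := f) (s := Finset.range n) (p := p) (μ := μ)
        (fun k _ => (hf k).aestronglyMeasurable) hp
      have h2 := h.trans (ENNReal.sum_le_tsum _)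
      rw [eLpNorm_eq_lintegral_rpow_enorm_toReal hp0 hpt, one_div,
        ENNReal.rpow_inv_le_iff hpos] at h2
      simpa using h2
    rw [eLpNorm_eq_lintegral_rpow_enorm_toReal hp0 hpt, one_div, ENNReal.rpow_inv_le_iff hpos]
    refine le_of_tendsto' (lintegral_tendsto_of_tendsto_of_monotone
      (fun n => ((Finset.measurable_fun_sum _ fun k _ => hf k).pow_const _).aemeasurable)
      (Filter.Eventually.of_forall fun x m n hmn => ?_)
      (Filter.Eventually.of_forall fun x => ?_)) hfin
    · exact ENNReal.rpow_le_rpow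
        (Finset.sum_le_sum_of_subset (Finset.range_mono hmn)) hpos.le
    · exact (ENNReal.continuous_rpow_const.tendsto _).comp (ENNReal.tendsto_nat_tsum fun k => f k x)

/-- Cauchy–Schwarz for `b k = c k^{1/2} · (c k^{-1/2} b k)`. -/
theorem tsum_sq_le (b : ℕ → ℝ≥0∞) {c : ℕ → ℝ≥0∞} (hc : ∀ k, c k ≠ 0) (hc' : ∀ k, c k ≠ ∞) :
    (∑' k, b k) ^ 2 ≤ (∑' k, c k) * ∑' k, (c k)⁻¹ * b k ^ 2 := by
  have h : ∑' k, b k ≤ (∑' k, c k) ^ (1 / 2 : ℝ) * (∑' k, (c k)⁻¹ * b k ^ 2) ^ (1 / 2 : ℝ) := by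
    refine ENNReal.summable.tsum_le_of_sum_le fun s => ?_
    have h := ENNReal.inner_le_Lp_mul_Lq s (fun k => c k ^ (1 / 2 : ℝ))
      (fun k => (c k)⁻¹ ^ (1 / 2 : ℝ) * b k) Real.HolderConjugate.two_two
    have e1 : ∀ k, c k ^ (1 / 2 : ℝ) * ((c k)⁻¹ ^ (1 / 2 : ℝ) * b k) = b k := fun k => by
      rw [← mul_assoc, ← ENNReal.mul_rpow_of_nonneg _ _ (by norm_num),
        ENNReal.mul_inv_cancel (hc k) (hc' k), ENNReal.one_rpow, one_mul]
    have e2 : ∀ k, (c k ^ (1 / 2 : ℝ)) ^ (2 : ℝ) = c k := fun k => by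
      rw [← ENNReal.rpow_mul]; norm_num
    have e3 : ∀ k, ((c k)⁻¹ ^ (1 / 2 : ℝ) * b k) ^ (2 : ℝ) = (c k)⁻¹ * b k ^ 2 := fun k => by
      rw [ENNReal.mul_rpow_of_nonneg _ _ (by norm_num), ← ENNReal.rpow_mul]; norm_num
    simp only [e1, e2, e3] at h
    refine h.trans ?_
    gcongr <;> exact ENNReal.sum_le_tsum _
  calc (∑' k, b k) ^ 2 ≤
        ((∑' k, c k) ^ (1 / 2 : ℝ) * (∑' k, (c k)⁻¹ * b k ^ 2) ^ (1 / 2 : ℝ)) ^ 2 := by gcongr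
    _ = _ := by
      rw [mul_pow, ← ENNReal.rpow_natCast, ← ENNReal.rpow_natCast, ← ENNReal.rpow_mul,
        ← ENNReal.rpow_mul]
      norm_num

end LpTools

/-! ### `L^r` bounds for densities from an operator norm and a bound on kernel rows. -/

section KernelBound

open ContinuousLinearMap (adjoint adjoint_inner_left adjoint_inner_right)

/-- `(TYeᵢ)(x) = ⟨Y* K x, eᵢ⟩`, and Parseval sums the squares over `i`. -/
theorem localDensity_comp_ae {T : L2 →L[ℂ] L2} {K : E3 → L2}
    (hK : ∀ f, T f =ᵐ[volume] fun x => ⟪K x, f⟫_ℂ) (Y : L2 →L[ℂ] L2) :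
    ∀ᵐ x, localDensity (T ∘L Y) x = ‖adjoint Y (K x)‖ₑ ^ 2 := by
  have h : ∀ᵐ x, ∀ i, T (Y (chosenBasis L2 i)) x = ⟪K x, Y (chosenBasis L2 i)⟫_ℂ :=
    ae_all_iff.2 fun i => hK _
  filter_upwards [h] with x hx
  unfold localDensity
  rw [← tsum_enorm_inner_sq (chosenBasis L2)]
  refine tsum_congr fun i => ?_
  rw [ContinuousLinearMap.comp_apply, hx, ← adjoint_inner_left, ← inner_conj_symm,
    RCLike.enorm_conj]

theorem enorm_le_ofReal {E : Type*} [SeminormedAddCommGroup E] {v : E} {a : ℝ} (h : ‖v‖ ≤ a) :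
    ‖v‖ₑ ≤ ENNReal.ofReal a := by
  rw [← ofReal_norm]; exact ENNReal.ofReal_le_ofReal h

theorem norm_adjoint_apply_le {G : L2 →L[ℂ] L2} (hG : ‖G‖ ≤ 1) {v : L2} {M : ℝ} (hv : ‖v‖ ≤ M) :
    ‖adjoint G v‖ ≤ M := by
  refine ((adjoint G).le_opNorm _).trans ?_
  rw [LinearIsometryEquiv.norm_map]
  exact (mul_le_of_le_one_left (norm_nonneg _) hG).trans hv

theorem hsSq_comp_comp_le {T G : L2 →L[ℂ] L2} {a : ℝ} (hT : ‖T‖ ≤ a) (hG : ‖G‖ ≤ 1)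
    (Y : L2 →L[ℂ] L2) : hsSq (T ∘L G ∘L Y) ≤ ENNReal.ofReal (a ^ 2) * hsSq Y := by
  rw [← ContinuousLinearMap.comp_assoc]
  refine (hsSq_comp_le _ _).trans ?_
  gcongr
  rw [← ofReal_norm_sq]
  refine ENNReal.ofReal_le_ofReal ?_
  gcongr
  refine (ContinuousLinearMap.opNorm_comp_le _ _).trans ?_
  exact (mul_le_of_le_one_right (norm_nonneg _) hG).trans hT

/-- For `r = 1` the integral of the density is a Hilbert–Schmidt sum; no kernel is needed, which is
why `t = 0` is allowed there. -/
theorem eLpNorm_one_localDensity_le {T G : L2 →L[ℂ] L2} {a : ℝ} (hT : ‖T‖ ≤ a) (hG : ‖G‖ ≤ 1)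
    (B : L2 →L[ℂ] L2) :
    eLpNorm (localDensity (T ∘L G ∘L absRoot 1 B)) 1 volume ≤
      ENNReal.ofReal (a ^ 2) * schattenNorm 1 B := by
  rw [schattenNorm_of_ne_top ENNReal.one_ne_top, eLpNorm_one_eq_lintegral_enorm]
  simp only [enorm_eq_self, ENNReal.toReal_one, div_one, ENNReal.rpow_one]
  rw [lintegral_localDensity]
  exact hsSq_comp_comp_le hT hG _

theorem eLpNorm_localDensity_le {r r' : ℝ≥0∞} [hrr : ENNReal.HolderConjugate r r']
    {T G : L2 →L[ℂ] L2} {a M : ℝ} (hT : ‖T‖ ≤ a) (hG : ‖G‖ ≤ 1) {K : E3 → L2}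
    (hK : ∀ f, T f =ᵐ[volume] fun x => ⟪K x, f⟫_ℂ) (hM : ∀ x, ‖K x‖ ≤ M) (B : L2 →L[ℂ] L2) :
    eLpNorm (localDensity (T ∘L G ∘L absRoot 1 B)) r volume ≤
      ENNReal.ofReal ((M ^ 2) ^ (r'⁻¹).toReal * (a ^ 2) ^ (r⁻¹).toReal) * schattenNorm r B := by
  have ha0 : 0 ≤ a := (norm_nonneg _).trans hT
  have hM0 : 0 ≤ M := (norm_nonneg _).trans (hM 0)
  have hadj : ∀ s, ∀ᵐ x, localDensity (T ∘L G ∘L absRoot s B) x =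
      ENNReal.ofReal (‖absRoot s B (adjoint G (K x))‖ ^ 2) := fun s => by
    filter_upwards [localDensity_comp_ae hK (G ∘L absRoot s B)] with x hx
    rw [hx, ContinuousLinearMap.adjoint_comp, ContinuousLinearMap.comp_apply, adjoint_absRoot,
      ofReal_norm_sq]
  have hv : ∀ x, ‖adjoint G (K x)‖ ≤ M := fun x => norm_adjoint_apply_le hG (hM x)
  have hr1 : 1 ≤ r := hrr.one_le
  have hsum : (r⁻¹).toReal + (r'⁻¹).toReal = 1 := by
    have hr' : 1 ≤ r' := hrr.symm.one_le
    rw [← ENNReal.toReal_add (by simpa using (zero_lt_one.trans_le hr1).ne')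
      (by simpa using (zero_lt_one.trans_le hr').ne'),
      ENNReal.HolderConjugate.inv_add_inv_eq_one r r', ENNReal.toReal_one]
  rcases eq_or_ne r ∞ with rfl | hrt
  · have hr'1 : (r'⁻¹).toReal = 1 := by simpa using hsum
    rw [hr'1, schattenNorm, if_pos rfl]
    simp only [ENNReal.inv_top, ENNReal.toReal_zero, Real.rpow_zero, mul_one, Real.rpow_one,
      eLpNorm_exponent_top]
    refine essSup_le_of_ae_le _ ?_
    filter_upwards [hadj 1] with x hx
    rw [enorm_eq_self, hx, ← ofReal_norm, ← ENNReal.ofReal_mul (by positivity)]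
    refine ENNReal.ofReal_le_ofReal ?_
    calc ‖absRoot 1 B (adjoint G (K x))‖ ^ 2
        ≤ ‖adjoint G (K x)‖ * ‖B (adjoint G (K x))‖ := norm_absRoot_one_sq_le _ _
      _ ≤ M * (‖B‖ * M) := by
          gcongr
          · exact hv x
          · exact B.le_opNorm_of_le (hv x)
      _ = M ^ 2 * ‖B‖ := by ring
  · have hr0 : r ≠ 0 := (zero_lt_one.trans_le hr1).ne'
    set s := r.toReal with hs
    have hs1 : 1 ≤ s := by
      rw [hs, ← ENNReal.toReal_one]
      exact ENNReal.toReal_mono hrt hr1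
    have hs0 : 0 < s := by linarith
    have hα : (r⁻¹).toReal = 1 / s := by rw [ENNReal.toReal_inv, one_div]
    have hα' : (r'⁻¹).toReal = (s - 1) * (1 / s) := by
      rw [hα] at hsum
      have : (s - 1) * (1 / s) = 1 - 1 / s := by field_simp
      linarith
    rw [schattenNorm_of_ne_top hrt, eLpNorm_eq_lintegral_rpow_enorm_toReal hr0 hrt, ← hs]
    simp only [enorm_eq_self]
    -- Pointwise Jensen for `v = G* (K x)`; the integral left on the right is the Hilbert–Schmidt
    -- sum of `T G |B|^{s/2}`.
    have hpt : ∫⁻ x, localDensity (T ∘L G ∘L absRoot 1 B) x ^ s ≤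
        ENNReal.ofReal ((M ^ 2) ^ (s - 1)) *
          ∫⁻ x, localDensity (T ∘L G ∘L absRoot s B) x := by
      rw [← lintegral_const_mul _ (measurable_localDensity _)]
      refine lintegral_mono_ae ?_
      filter_upwards [hadj 1, hadj s] with x hx hx'
      rw [hx, hx', ENNReal.ofReal_rpow_of_nonneg (by positivity) hs0.le,
        ← ENNReal.ofReal_mul (by positivity)]
      refine ENNReal.ofReal_le_ofReal ((norm_absRoot_one_sq_rpow_le B hs1 _).trans ?_)
      gcongr
      exact hv x
    have hhs := hsSq_comp_comp_le hT hG (absRoot s B)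
    rw [lintegral_localDensity] at hpt
    calc _ ≤ (ENNReal.ofReal ((M ^ 2) ^ (s - 1)) *
          (ENNReal.ofReal (a ^ 2) * hsSq (absRoot s B))) ^ (1 / s) := by
          gcongr
          exact hpt.trans (by gcongr)
      _ = _ := by
          rw [← mul_assoc, ← ENNReal.ofReal_mul (by positivity),
            ENNReal.mul_rpow_of_nonneg _ _ (by positivity),
            ENNReal.ofReal_rpow_of_nonneg (by positivity) (by positivity),
            Real.mul_rpow (by positivity) (by positivity), ← Real.rpow_mul (by positivity), hα, hα']

/-- Recombines the pieces of an operator: weighted Cauchy–Schwarz for each basis vector and point,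
then Minkowski. -/
theorem eLpNorm_localDensity_tsum_le {T : L2 →L[ℂ] L2} {Tk : ℕ → L2 →L[ℂ] L2}
    (hT : ∀ f, ∀ᵐ x, ‖T f x‖ₑ ≤ ∑' k, ‖Tk k f x‖ₑ) (Y : L2 →L[ℂ] L2)
    {c : ℕ → ℝ≥0∞} (hc : ∀ k, c k ≠ 0) (hc' : ∀ k, c k ≠ ∞) {r : ℝ≥0∞} (hr : 1 ≤ r)
    (hsum : ∑' k, c k ≠ ∞) :
    eLpNorm (localDensity (T ∘L Y)) r volume ≤
      (∑' k, c k) * ∑' k, (c k)⁻¹ * eLpNorm (localDensity (Tk k ∘L Y)) r volume := by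
  have hsm : ∀ {b : ℝ≥0∞}, b ≠ ∞ → ∀ {f : E3 → ℝ≥0∞},
      eLpNorm (fun x => b * f x) r volume ≤ b * eLpNorm f r volume := by
    intro b hb f
    lift b to NNReal using hb
    exact eLpNorm_le_nnreal_smul_eLpNorm_of_ae_le_mul'
      (Filter.Eventually.of_forall fun x => by simp) r
  have hae : ∀ᵐ x, localDensity (T ∘L Y) x ≤
      (∑' k, c k) * ∑' k, (c k)⁻¹ * localDensity (Tk k ∘L Y) x := by
    have h : ∀ᵐ x, ∀ i, ‖T (Y (chosenBasis L2 i)) x‖ₑ ≤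
        ∑' k, ‖Tk k (Y (chosenBasis L2 i)) x‖ₑ := ae_all_iff.2 fun i => hT _
    filter_upwards [h] with x hx
    calc localDensity (T ∘L Y) x
        ≤ ∑' i, (∑' k, c k) * ∑' k, (c k)⁻¹ * ‖Tk k (Y (chosenBasis L2 i)) x‖ₑ ^ 2 := by
          refine ENNReal.tsum_le_tsum fun i => le_trans ?_ (tsum_sq_le _ hc hc')
          gcongr
          exact hx i
      _ = _ := by
          rw [ENNReal.tsum_mul_left, ENNReal.tsum_comm]
          simp_rw [ENNReal.tsum_mul_left]
          rfl
  calc eLpNorm (localDensity (T ∘L Y)) r volume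
      ≤ eLpNorm (fun x => (∑' k, c k) * ∑' k, (c k)⁻¹ * localDensity (Tk k ∘L Y) x) r volume :=
        eLpNorm_mono_enorm_ae hae
    _ ≤ _ := by
        refine (hsm hsum).trans ?_
        gcongr
        refine (eLpNorm_tsum_le (fun k => (measurable_localDensity _).const_mul _) hr).trans ?_
        exact ENNReal.tsum_le_tsum fun k => hsm (ENNReal.inv_ne_top.2 (hc k))

end KernelBound

/-! ### Dyadic decomposition of the inverse weight. -/

section Weight

open ContinuousLinearMap (adjoint adjoint_inner_left adjoint_inner_right)

theorem norm_mulCLM_le {m : E3 → ℂ} (hm : Measurable m) (hb : ∀ x, ‖m x‖ ≤ 1) {a : ℝ}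
    (ha : ∀ x, ‖m x‖ ≤ a) : ‖mulCLM m hm hb‖ ≤ a := by
  refine ContinuousLinearMap.opNorm_le_bound _ ((norm_nonneg _).trans (ha 0)) fun f => ?_
  refine Lp.norm_le_mul_norm_of_ae_le_mul ?_
  filter_upwards [mulCLM_ae m hm hb f] with x hx
  rw [hx, norm_mul]
  gcongr
  exact ha x

theorem memLp_of_bounded_of_support {h : E3 → ℂ} (hm : Measurable h) {E : Set E3}
    (hE : MeasurableSet E) (hfin : volume E < ∞) {C : ℝ} (hC : ∀ x, ‖h x‖ ≤ C)
    (hsupp : ∀ x ∉ E, h x = 0) :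
    ∃ hh : MemLp h 2 volume, ‖hh.toLp h‖ ^ 2 ≤ C ^ 2 * (volume E).toReal := by
  have hC0 : 0 ≤ C := (norm_nonneg _).trans (hC 0)
  have hle : ∫⁻ x, ‖h x‖ₑ ^ 2 ≤ ENNReal.ofReal (C ^ 2) * volume E := by
    calc ∫⁻ x, ‖h x‖ₑ ^ 2 ≤ ∫⁻ x, E.indicator (fun _ => ENNReal.ofReal (C ^ 2)) x := by
          refine lintegral_mono fun x => ?_
          by_cases hx : x ∈ E
          · rw [Set.indicator_of_mem hx, ← ofReal_norm_sq]
            refine ENNReal.ofReal_le_ofReal ?_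
            gcongr
            exact hC x
          · simp [hsupp x hx]
      _ = _ := lintegral_indicator_const hE _
  have hlt : ∫⁻ x, ‖h x‖ₑ ^ 2 < ∞ := hle.trans_lt (ENNReal.mul_lt_top ENNReal.ofReal_lt_top hfin)
  have hh : MemLp h 2 volume := by
    refine ⟨hm.aestronglyMeasurable, ?_⟩
    rw [eLpNorm_lt_top_iff_lintegral_rpow_enorm_lt_top two_ne_zero ENNReal.ofNat_ne_top]
    simpa using hlt
  refine ⟨hh, ?_⟩
  have h1 : ‖hh.toLp h‖ₑ ^ 2 ≤ ENNReal.ofReal (C ^ 2) * volume E := by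
    rw [enorm_sq_eq_lintegral]
    refine le_trans (lintegral_congr_ae ?_).le hle
    filter_upwards [hh.coeFn_toLp] with x hx
    rw [hx]
  rw [← ofReal_norm_sq, ← ENNReal.ofReal_toReal hfin.ne, ← ENNReal.ofReal_mul (by positivity)] at h1
  exact (ENNReal.ofReal_le_ofReal_iff (by positivity)).1 h1

/-- `V` is, on integrable functions, an integral operator with a kernel bounded by `κ`. -/
def HasBoundedKernel (V : L2 →L[ℂ] L2) (κ : ℝ) : Prop :=
  ∃ k : E3 → E3 → ℂ, (∀ x, Measurable (k x)) ∧ (∀ x y, ‖k x y‖ ≤ κ) ∧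
    ∀ g : L2, Integrable g volume → V g =ᵐ[volume] fun x => ∫ y, k x y * g y

/-- A symbol supported on a set of finite measure maps `L²` into `L¹`, where the kernel formula
applies, and puts the rows in `L²`. -/
theorem HasBoundedKernel.comp_mulCLM {V : L2 →L[ℂ] L2} {κ : ℝ} (hV : HasBoundedKernel V κ)
    {m : E3 → ℂ} (hm : Measurable m) (hb : ∀ x, ‖m x‖ ≤ 1) {E : Set E3} (hE : MeasurableSet E)
    (hfin : volume E < ∞) {a : ℝ} (ha : ∀ x, ‖m x‖ ≤ a) (hsupp : ∀ x ∉ E, m x = 0) :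
    ∃ K : E3 → L2, (∀ f, (V ∘L mulCLM m hm hb) f =ᵐ[volume] fun x => ⟪K x, f⟫_ℂ) ∧
      ∀ x, ‖K x‖ ^ 2 ≤ (κ * a) ^ 2 * (volume E).toReal := by
  obtain ⟨k, hkm, hkb, hkV⟩ := hV
  have hκ : 0 ≤ κ := (norm_nonneg _).trans (hkb 0 0)
  have hK : ∀ x, ∃ hh : MemLp (fun y => (starRingEnd ℂ) (k x y * m y)) 2 volume,
      ‖hh.toLp _‖ ^ 2 ≤ (κ * a) ^ 2 * (volume E).toReal := fun x => by
    refine memLp_of_bounded_of_support ?_ hE hfin (fun y => ?_) (fun y hy => ?_)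
    · exact Complex.continuous_conj.measurable.comp ((hkm x).mul hm)
    · rw [RCLike.norm_conj, norm_mul]
      exact mul_le_mul (hkb x y) (ha y) (norm_nonneg _) hκ
    · simp [hsupp y hy]
  choose hmem hnorm using hK
  refine ⟨fun x => (hmem x).toLp _, fun f => ?_, hnorm⟩
  obtain ⟨hm2, -⟩ := memLp_of_bounded_of_support hm hE hfin ha hsupp
  have hint : Integrable (mulCLM m hm hb f) volume := by
    have h : Integrable (fun x => m x * f x) volume := hm2.integrable_mul (Lp.memLp f)
    exact h.congr (mulCLM_ae m hm hb f).symm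
  filter_upwards [hkV _ hint] with x hx
  rw [ContinuousLinearMap.comp_apply, hx, L2.inner_def]
  refine integral_congr_ae ?_
  filter_upwards [mulCLM_ae m hm hb f, (hmem x).coeFn_toLp] with y hy hy'
  rw [hy, hy']
  simp [RCLike.inner_apply]
  ring

theorem one_le_bracket (x : E3) : 1 ≤ bracket x := by
  unfold bracket
  rw [Real.one_le_sqrt]
  nlinarith [norm_nonneg x]

theorem bracket_pos (x : E3) : 0 < bracket x := zero_lt_one.trans_le (one_le_bracket x)

theorem norm_lt_bracket (x : E3) : ‖x‖ < bracket x := by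
  unfold bracket
  exact Real.lt_sqrt_of_sq_lt (by linarith)

theorem measurable_bracket_smul (lam : ℝ) : Measurable fun y : E3 => bracket (lam • y) := by
  unfold bracket
  fun_prop

/-- The inverse weight `⟨λy⟩^{-σ}`. -/
def invWeight (lam σ : ℝ) (y : E3) : ℂ := ((bracket (lam • y) ^ (-σ) : ℝ) : ℂ)

theorem measurable_invWeight (lam σ : ℝ) : Measurable (invWeight lam σ) :=
  Complex.measurable_ofReal.comp ((measurable_bracket_smul lam).pow_const _)

theorem norm_invWeight (lam σ : ℝ) (y : E3) : ‖invWeight lam σ y‖ = bracket (lam • y) ^ (-σ) := by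
  rw [invWeight, Complex.norm_real, Real.norm_of_nonneg (Real.rpow_nonneg (bracket_pos _).le _)]

theorem norm_invWeight_le (lam : ℝ) {σ : ℝ} (hσ : 0 ≤ σ) (y : E3) : ‖invWeight lam σ y‖ ≤ 1 := by
  rw [norm_invWeight]
  exact Real.rpow_le_one_of_one_le_of_nonpos (one_le_bracket _) (by linarith)

/-- The dyadic shell `2^k ≤ ⟨λy⟩ < 2^{k+1}`. -/
def shell (lam : ℝ) (k : ℕ) : Set E3 :=
  {y | (2 : ℝ) ^ k ≤ bracket (lam • y) ∧ bracket (lam • y) < 2 ^ (k + 1)}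

theorem measurableSet_shell (lam : ℝ) (k : ℕ) : MeasurableSet (shell lam k) :=
  (measurableSet_le measurable_const (measurable_bracket_smul lam)).inter
    (measurableSet_lt (measurable_bracket_smul lam) measurable_const)

theorem exists_unique_shell (lam : ℝ) (y : E3) :
    ∃ k, y ∈ shell lam k ∧ ∀ j, y ∈ shell lam j → j = k := by
  obtain ⟨k, hk, hk'⟩ := exists_nat_pow_near (one_le_bracket (lam • y)) (one_lt_two (α := ℝ))
  refine ⟨k, ⟨hk, hk'⟩, fun j hj => ?_⟩
  have h1 : j < k + 1 := (pow_lt_pow_iff_right₀ (one_lt_two (α := ℝ))).1 (hj.1.trans_lt hk')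
  have h2 : k < j + 1 := (pow_lt_pow_iff_right₀ (one_lt_two (α := ℝ))).1 (hk.trans_lt hj.2)
  omega

/-- The volume of the unit ball. -/
def unitBallVolume : ℝ := (volume (Metric.ball (0 : E3) 1)).toReal

theorem unitBallVolume_pos : 0 < unitBallVolume :=
  ENNReal.toReal_pos (Metric.measure_ball_pos _ _ one_pos).ne' measure_ball_lt_top.ne

theorem volume_shell_le {lam : ℝ} (hlam : 0 < lam) (k : ℕ) :
    volume (shell lam k) ≤ ENNReal.ofReal ((2 ^ (k + 1) / lam) ^ 3 * unitBallVolume) := by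
  have hsub : shell lam k ⊆ Metric.ball 0 (2 ^ (k + 1) / lam) := fun y hy => by
    rw [mem_ball_zero_iff, lt_div_iff₀ hlam, mul_comm]
    have h := (norm_lt_bracket (lam • y)).trans hy.2
    rwa [norm_smul, Real.norm_of_nonneg hlam.le] at h
  refine (measure_mono hsub).trans ?_
  rw [Measure.addHaar_ball _ _ (by positivity), ENNReal.ofReal_mul (by positivity),
    unitBallVolume, ENNReal.ofReal_toReal measure_ball_lt_top.ne]
  simp

/-- The part of the inverse weight on a dyadic shell. -/
def shellWeight (lam σ : ℝ) (k : ℕ) : E3 → ℂ := (shell lam k).indicator (invWeight lam σ)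

theorem measurable_shellWeight (lam σ : ℝ) (k : ℕ) : Measurable (shellWeight lam σ k) :=
  (measurable_invWeight lam σ).indicator (measurableSet_shell lam k)

theorem norm_shellWeight_le_pow (lam : ℝ) {σ : ℝ} (hσ : 0 ≤ σ) (k : ℕ) (y : E3) :
    ‖shellWeight lam σ k y‖ ≤ ((2 : ℝ) ^ (-σ)) ^ k := by
  unfold shellWeight
  by_cases hy : y ∈ shell lam k
  · rw [Set.indicator_of_mem hy, norm_invWeight, ← Real.rpow_natCast, ← Real.rpow_mul two_pos.le,
      mul_comm, Real.rpow_mul two_pos.le, Real.rpow_natCast]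
    exact Real.rpow_le_rpow_of_nonpos (by positivity) hy.1 (by linarith)
  · rw [Set.indicator_of_notMem hy, norm_zero]
    positivity

theorem norm_shellWeight_le (lam : ℝ) {σ : ℝ} (hσ : 0 ≤ σ) (k : ℕ) (y : E3) :
    ‖shellWeight lam σ k y‖ ≤ 1 :=
  (norm_indicator_le_norm_self _ _).trans (norm_invWeight_le lam hσ y)

theorem hasSum_shellWeight (lam σ : ℝ) (y : E3) :
    HasSum (fun k => shellWeight lam σ k y) (invWeight lam σ y) := by
  obtain ⟨k, hk, huniq⟩ := exists_unique_shell lam y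
  have h := hasSum_single (f := fun k => shellWeight lam σ k y) k fun j hj =>
    Set.indicator_of_notMem (fun hy => hj (huniq j hy)) _
  simpa [shellWeight, Set.indicator_of_mem hk] using h

/-- Multiplication by `⟨λy⟩^{-σ}`. -/
def invWeightCLM (lam : ℝ) {σ : ℝ} (hσ : 0 ≤ σ) : L2 →L[ℂ] L2 :=
  mulCLM _ (measurable_invWeight lam σ) (norm_invWeight_le lam hσ)

/-- Multiplication by the part of `⟨λy⟩^{-σ}` on a dyadic shell. -/
def shellCLM (lam : ℝ) {σ : ℝ} (hσ : 0 ≤ σ) (k : ℕ) : L2 →L[ℂ] L2 :=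
  mulCLM _ (measurable_shellWeight lam σ k) (norm_shellWeight_le lam hσ k)

theorem norm_shellCLM_le (lam : ℝ) {σ : ℝ} (hσ : 0 ≤ σ) (k : ℕ) :
    ‖shellCLM lam hσ k‖ ≤ ((2 : ℝ) ^ (-σ)) ^ k :=
  norm_mulCLM_le _ _ (norm_shellWeight_le_pow lam hσ k)

theorem tsum_enorm_ne_top_of_geometric {v : ℕ → L2} {q C : ℝ} (hq0 : 0 ≤ q) (hq : q < 1)
    (hv : ∀ k, ‖v k‖ ≤ q ^ k * C) : ∑' k, ‖v k‖ₑ ≠ ∞ := by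
  rw [tsum_enorm_ne_top_iff_summable_norm]
  exact Summable.of_nonneg_of_le (fun _ => norm_nonneg _) hv
    ((summable_geometric_of_lt_one hq0 hq).mul_right C)

/-- The shell pieces have geometrically decaying norms because `σ > 0`, so their sum converges in
`L²` and almost everywhere, also after applying `V`. -/
theorem enorm_comp_invWeightCLM_le {V : L2 →L[ℂ] L2} (lam : ℝ) {σ : ℝ} (hσ : 0 < σ) (f : L2) :
    ∀ᵐ x, ‖(V ∘L invWeightCLM lam hσ.le) f x‖ₑ ≤
      ∑' k, ‖(V ∘L shellCLM lam hσ.le k) f x‖ₑ := by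
  have hq0 : (0 : ℝ) ≤ 2 ^ (-σ) := by positivity
  have hq : (2 : ℝ) ^ (-σ) < 1 := Real.rpow_lt_one_of_one_lt_of_neg one_lt_two (by linarith)
  have hb : ∀ k, ‖shellCLM lam hσ.le k f‖ ≤ ((2 : ℝ) ^ (-σ)) ^ k * ‖f‖ := fun k =>
    (shellCLM lam hσ.le k).le_of_opNorm_le (norm_shellCLM_le lam hσ.le k) f
  have hfin := tsum_enorm_ne_top_of_geometric hq0 hq hb
  have hbV : ∀ k, ‖V (shellCLM lam hσ.le k f)‖ ≤ ((2 : ℝ) ^ (-σ)) ^ k * (‖V‖ * ‖f‖) := fun k => by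
    refine (V.le_opNorm_of_le (hb k)).trans_eq (by ring)
  have hfinV := tsum_enorm_ne_top_of_geometric hq0 hq hbV
  have hsum : invWeightCLM lam hσ.le f = ∑' k, shellCLM lam hσ.le k f := by
    refine Lp.ext ?_
    have hall : ∀ᵐ x, ∀ k, shellCLM lam hσ.le k f x = shellWeight lam σ k x * f x :=
      ae_all_iff.2 fun k => mulCLM_ae _ _ _ f
    filter_upwards [Lp.hasSum_coeFn_tsum hfin, hall, mulCLM_ae _ (measurable_invWeight lam σ)
      (norm_invWeight_le lam hσ.le) f] with x hx hx' hx''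
    rw [invWeightCLM, hx'']
    simp only [hx'] at hx
    exact ((hasSum_shellWeight lam σ x).mul_right (f x)).unique hx
  have hV : (V ∘L invWeightCLM lam hσ.le) f = ∑' k, V (shellCLM lam hσ.le k f) := by
    rw [ContinuousLinearMap.comp_apply, hsum, V.map_tsum (Summable.of_enorm hfin)]
  rw [hV]
  filter_upwards [Lp.coeFn_tsum hfinV] with x hx
  rw [hx]
  exact enorm_tsum_le_tsum_enorm

theorem shell_ratio_lt_one {σ α : ℝ} (hσ : 3 / 2 * α < σ) : (2 : ℝ) ^ (3 * α - 2 * σ) < 1 :=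
  Real.rpow_lt_one_of_one_lt_of_neg one_lt_two (by linarith)

/-- The constant in the weighted density bound. -/
def weightConst (σ α : ℝ) : ℝ :=
  (8 * unitBallVolume) ^ α * ((1 - Real.sqrt (2 ^ (3 * α - 2 * σ)))⁻¹) ^ 2

theorem weightConst_pos {σ α : ℝ} (hσ : 3 / 2 * α < σ) : 0 < weightConst σ α := by
  have h : Real.sqrt (2 ^ (3 * α - 2 * σ)) < 1 := by
    rw [Real.sqrt_lt' one_pos, one_pow]
    exact shell_ratio_lt_one hσ
  have h' : 0 < 1 - Real.sqrt (2 ^ (3 * α - 2 * σ)) := by linarith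
  have := unitBallVolume_pos
  unfold weightConst
  positivity

theorem toReal_inv_add_toReal_inv (r r' : ℝ≥0∞) [hrr : ENNReal.HolderConjugate r r'] :
    (r⁻¹).toReal + (r'⁻¹).toReal = 1 := by
  rw [← ENNReal.toReal_add (by simpa using (zero_lt_one.trans_le hrr.one_le).ne')
    (by simpa using (zero_lt_one.trans_le hrr.symm.one_le).ne'),
    ENNReal.HolderConjugate.inv_add_inv_eq_one r r', ENNReal.toReal_one]

theorem eLpNorm_localDensity_invWeight_le {r r' : ℝ≥0∞} [hrr : ENNReal.HolderConjugate r r']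
    {V G : L2 →L[ℂ] L2} {κ lam σ : ℝ} (hV : ‖V‖ ≤ 1) (hG : ‖G‖ ≤ 1) (hk : HasBoundedKernel V κ)
    (hlam : 0 < lam) (hσ0 : 0 < σ) (hσ : 3 / 2 * (r'⁻¹).toReal < σ) (B : L2 →L[ℂ] L2) :
    eLpNorm (localDensity ((V ∘L invWeightCLM lam hσ0.le) ∘L G ∘L absRoot 1 B)) r volume ≤
      ENNReal.ofReal (weightConst σ (r'⁻¹).toReal * (κ ^ 2 / lam ^ 3) ^ (r'⁻¹).toReal) *
        schattenNorm r B := by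
  set α := (r'⁻¹).toReal with hα
  have hα0 : 0 ≤ α := ENNReal.toReal_nonneg
  have hsumα : (r⁻¹).toReal = 1 - α := by
    have := toReal_inv_add_toReal_inv r r'
    linarith
  have hvol := unitBallVolume_pos
  set q : ℝ := 2 ^ (3 * α - 2 * σ) with hq
  have hq0 : 0 < q := by positivity
  set p := Real.sqrt q with hp
  have hp0 : 0 < p := Real.sqrt_pos.2 hq0
  have hpq : p ^ 2 = q := Real.sq_sqrt hq0.le
  have hp1 : p < 1 := by
    rw [hp, Real.sqrt_lt' one_pos, one_pow]
    exact shell_ratio_lt_one hσ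
  set D := (κ ^ 2 / lam ^ 3) ^ α * (8 * unitBallVolume) ^ α with hD
  have hD0 : 0 ≤ D := by positivity
  have hκ : 0 ≤ κ := by
    obtain ⟨k, -, h, -⟩ := hk
    exact (norm_nonneg _).trans (h 0 0)
  have hterm : ∀ k : ℕ, eLpNorm (localDensity ((V ∘L shellCLM lam hσ0.le k) ∘L G ∘L absRoot 1 B))
      r volume ≤ ENNReal.ofReal (D * q ^ k) * schattenNorm r B := fun k => by
    have hfin : volume (shell lam k) < ∞ := (volume_shell_le hlam k).trans_lt ENNReal.ofReal_lt_top
    set a : ℝ := ((2 : ℝ) ^ (-σ)) ^ k with ha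
    have ha0 : 0 < a := by positivity
    obtain ⟨K, hK, hKn⟩ := hk.comp_mulCLM (measurable_shellWeight lam σ k)
      (norm_shellWeight_le lam hσ0.le k) (measurableSet_shell lam k) hfin
      (norm_shellWeight_le_pow lam hσ0.le k) (fun x hx => Set.indicator_of_notMem hx _)
    have hvr : (volume (shell lam k)).toReal ≤ (2 ^ (k + 1) / lam) ^ 3 * unitBallVolume :=
      ENNReal.toReal_le_of_le_ofReal (by positivity) (volume_shell_le hlam k)
    set M2 : ℝ := (κ * a) ^ 2 * ((2 ^ (k + 1) / lam) ^ 3 * unitBallVolume) with hM2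
    have hM20 : 0 ≤ M2 := by positivity
    have hKM : ∀ x, ‖K x‖ ≤ Real.sqrt M2 := fun x =>
      Real.le_sqrt_of_sq_le ((hKn x).trans (mul_le_mul_of_nonneg_left hvr (by positivity)))
    have hTa : ‖V ∘L shellCLM lam hσ0.le k‖ ≤ a := by
      refine (ContinuousLinearMap.opNorm_comp_le _ _).trans ?_
      exact (mul_le_of_le_one_left (norm_nonneg _) hV).trans (norm_shellCLM_le lam hσ0.le k)
    refine (eLpNorm_localDensity_le (r' := r') hTa hG hK hKM B).trans_eq ?_
    congr 2
    rw [Real.sq_sqrt hM20, hsumα]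
    -- The ball containing the shell has radius `2^{k+1}/λ`: the extra factor 2 cubed is the 8 in
    -- `weightConst`, and `8^k` is the growth to be beaten by `a²`.
    have e1 : M2 = a ^ 2 * ((κ ^ 2 / lam ^ 3) * (8 * unitBallVolume) * 8 ^ k) := by
      have : (2 : ℝ) ^ (k + 1) = 2 ^ k * 2 := pow_succ _ _
      have h8 : (8 : ℝ) ^ k = (2 ^ k) ^ 3 := by rw [← pow_mul, mul_comm, pow_mul]; norm_num
      rw [hM2, this, h8]
      field_simp
      ring
    have e2 : (a ^ 2) ^ α * (a ^ 2) ^ (1 - α) = a ^ 2 := by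
      rw [← Real.rpow_add (by positivity)]; simp
    have e3 : a ^ 2 * ((8 : ℝ) ^ k) ^ α = q ^ k := by
      have h8 : (8 : ℝ) = 2 ^ (3 : ℝ) := by norm_num
      rw [ha, hq, h8, ← Real.rpow_natCast, ← Real.rpow_natCast, ← Real.rpow_natCast,
        ← Real.rpow_natCast, ← Real.rpow_mul two_pos.le, ← Real.rpow_mul two_pos.le,
        ← Real.rpow_mul two_pos.le, ← Real.rpow_mul two_pos.le, ← Real.rpow_mul two_pos.le,
        ← Real.rpow_add two_pos]
      congr 1
      push_cast
      ring
    rw [e1, Real.mul_rpow (by positivity) (by positivity),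
      Real.mul_rpow (by positivity) (by positivity), Real.mul_rpow (by positivity) (by positivity),
      hD]
    linear_combination ((κ ^ 2 / lam ^ 3) ^ α * (8 * unitBallVolume) ^ α * ((8 : ℝ) ^ k) ^ α) * e2 +
      ((κ ^ 2 / lam ^ 3) ^ α * (8 * unitBallVolume) ^ α) * e3
  have hc : ∀ k : ℕ, ENNReal.ofReal (p ^ k) ≠ 0 := fun k => by
    rw [Ne, ENNReal.ofReal_eq_zero, not_le]; positivity
  have hsum : ∑' k : ℕ, ENNReal.ofReal (p ^ k) = ENNReal.ofReal (1 - p)⁻¹ := by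
    rw [← ENNReal.ofReal_tsum_of_nonneg (fun k => by positivity)
      (summable_geometric_of_lt_one hp0.le hp1), tsum_geometric_of_lt_one hp0.le hp1]
  -- Weights `p^k` with `p = √q` balance the two series: `p^{-k} q^k = p^k`, so each sums to
  -- `(1-p)⁻¹`.
  refine (eLpNorm_localDensity_tsum_le (enorm_comp_invWeightCLM_le lam hσ0) (G ∘L absRoot 1 B)
    hc (fun k => ENNReal.ofReal_ne_top) hrr.one_le (hsum ▸ ENNReal.ofReal_ne_top)).trans ?_
  rw [hsum]
  have hp1' : 0 < 1 - p := by linarith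
  calc _ ≤ ENNReal.ofReal (1 - p)⁻¹ *
        ∑' k : ℕ, ENNReal.ofReal (p ^ k) * (ENNReal.ofReal D * schattenNorm r B) := by
        refine mul_le_mul_right (ENNReal.tsum_le_tsum fun k => ?_) _
        refine (mul_le_mul_right (hterm k) _).trans_eq ?_
        rw [← mul_assoc, ← mul_assoc, ← ENNReal.ofReal_inv_of_pos (by positivity),
          ← ENNReal.ofReal_mul (by positivity), ← ENNReal.ofReal_mul (by positivity), ← hpq]
        congr 2
        field_simp
        ring
    _ = _ := by
        rw [ENNReal.tsum_mul_right, hsum, ← mul_assoc, ← mul_assoc,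
          ← ENNReal.ofReal_mul (by positivity), ← ENNReal.ofReal_mul (by positivity)]
        congr 2
        rw [hD, weightConst]
        ring

end Weight

/-! ### Existence and bound of the density of `(TG)B(TG)*`. -/

section Conclusion

open ContinuousLinearMap (adjoint adjoint_inner_left adjoint_inner_right)

theorem setLIntegral_lt_top_of_eLpNorm {n : E3 → ℝ≥0∞} (hn : Measurable n) {r : ℝ≥0∞}
    (hr : 1 ≤ r) (h : eLpNorm n r volume < ∞) {S : Set E3} (hb : Bornology.IsBounded S) :
    ∫⁻ x in S, n x < ∞ := by
  have h1 := eLpNorm_le_eLpNorm_mul_rpow_measure_univ hr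
    (hn.aestronglyMeasurable (μ := (volume : Measure E3).restrict S))
  rw [eLpNorm_one_eq_lintegral_enorm] at h1
  refine h1.trans_lt (ENNReal.mul_lt_top ?_ ?_)
  · exact (eLpNorm_mono_measure _ Measure.restrict_le_self).trans_lt h
  · refine ENNReal.rpow_lt_top_of_nonneg ?_ ?_
    · rw [ENNReal.toReal_one, div_one, sub_nonneg]
      rcases eq_or_ne r ∞ with rfl | hrt
      · simp
      · refine div_le_one_of_le₀ ?_ ENNReal.toReal_nonneg
        rw [← ENNReal.toReal_one]
        exact ENNReal.toReal_mono hrt hr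
    · simpa using hb.measure_lt_top.ne

/-- The hypothesis covers all contractions because it is used twice: with `G ∘ U` for the left
factor and with `G` for the right one. -/
theorem exists_isDensity_and_bound {r : ℝ≥0∞} (hr : 1 ≤ r) {T G B : L2 →L[ℂ] L2} (hG : ‖G‖ ≤ 1)
    (ħ : ℝ) {D : ℝ≥0∞} (hD : D < ∞)
    (h : ∀ G' : L2 →L[ℂ] L2, ‖G'‖ ≤ 1 →
      eLpNorm (localDensity (T ∘L G' ∘L absRoot 1 B)) r volume ≤ D) {A : L2 →L[ℂ] L2}
    (hA : A = (T ∘L G) ∘L B ∘L adjoint (T ∘L G)) :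
    (∃ ρ, IsDensity ħ A ρ) ∧ ∀ ρ, IsDensity ħ A ρ →
      eLpNorm ρ r volume ≤ ENNReal.ofReal (|2 * Real.pi * ħ| ^ 3) * (D + D) := by
  obtain ⟨U, hU, hUB⟩ := exists_comp_absRoot_eq B
  set X := T ∘L (G ∘L U) ∘L absRoot 1 B with hX
  set Y := T ∘L G ∘L absRoot 1 B with hY
  have hGU : ‖G ∘L U‖ ≤ 1 :=
    (ContinuousLinearMap.opNorm_comp_le _ _).trans (mul_le_one₀ hG (norm_nonneg _) hU)
  have hXD := h _ hGU
  have hYD := h _ hG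
  have hAXY : A = X ∘L adjoint Y := hA.trans (conj_eq_comp_adjoint T G hUB)
  have hden : IsDensity ħ A (fun x => (((2 * Real.pi * ħ) ^ 3 : ℝ) : ℂ) * pairDensity X Y x) := by
    rw [hAXY]
    exact isDensity_pairDensity ħ
      (fun S _ hb => setLIntegral_lt_top_of_eLpNorm (measurable_localDensity X) hr
        (hXD.trans_lt hD) hb)
      (fun S _ hb => setLIntegral_lt_top_of_eLpNorm (measurable_localDensity Y) hr
        (hYD.trans_lt hD) hb)
  refine ⟨⟨_, hden⟩, fun ρ hρ => ?_⟩
  rw [eLpNorm_congr_ae (hρ.ae_eq hden)]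
  refine (eLpNorm_le_mul_eLpNorm_of_ae_le_mul''
    (g := fun x => localDensity X x + localDensity Y x)
    (c := ENNReal.ofReal (|2 * Real.pi * ħ| ^ 3)) r ((measurable_localDensity X).add (measurable_localDensity Y)).aestronglyMeasurable
    (Filter.Eventually.of_forall fun x => ?_)).trans ?_
  · rw [enorm_mul, enorm_eq_self]
    gcongr
    · rw [← ofReal_norm, Complex.norm_real, norm_pow, Real.norm_eq_abs]
    · exact enorm_pairDensity_le X Y x
  · gcongr
    exact (eLpNorm_add_le (measurable_localDensity X).aestronglyMeasurable
      (measurable_localDensity Y).aestronglyMeasurable hr).trans (add_le_add hXD hYD)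

end Conclusion

/-! ### Integral kernels of `𝓕⁻¹` and of the free flow. -/

section Fourier

theorem continuous_fourier_of_integrable {f : E3 → ℂ} (hf : Integrable f volume) :
    Continuous (𝓕 f) :=
  VectorFourier.fourierIntegral_continuous Real.continuous_fourierChar continuous_inner hf

theorem integral_fourier_mul_eq {f g : E3 → ℂ} (hf : Integrable f volume)
    (hg : Integrable g volume) : ∫ x, 𝓕 f x * g x = ∫ x, f x * 𝓕 g x := by
  have h := VectorFourier.integral_fourierIntegral_smul_eq_flip (L := innerₗ E3)
    Real.continuous_fourierChar continuous_inner hf hg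
  rw [flip_innerₗ] at h
  exact h

theorem integral_fourierInv_mul_eq {f g : E3 → ℂ} (hf : Integrable f volume)
    (hg : Integrable g volume) : ∫ x, 𝓕⁻ f x * g x = ∫ x, f x * 𝓕⁻ g x := by
  -- Changing the sign of the pairing turns the Fourier integral into its inverse.
  have h := VectorFourier.integral_fourierIntegral_smul_eq_flip (L := -innerₗ E3)
    Real.continuous_fourierChar (continuous_inner.neg) hf hg
  have e : (-innerₗ E3).flip = -innerₗ E3 := by
    ext x y; simp [real_inner_comm]
  rw [e] at h
  exact h

theorem ae_eq_of_forall_schwartz {f f' : E3 → ℂ} (hf : LocallyIntegrable f volume)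
    (hf' : LocallyIntegrable f' volume)
    (h : ∀ φ : SchwartzMap E3 ℂ, ∫ x, φ x * f x = ∫ x, φ x * f' x) : f =ᵐ[volume] f' := by
  refine ae_eq_of_integral_contDiff_smul_eq hf hf' fun g hg hgc => ?_
  have hg₁ : HasCompactSupport (Complex.ofRealCLM ∘ g) := hgc.comp_left rfl
  have hg₂ : ContDiff ℝ (⊤ : ℕ∞) (Complex.ofRealCLM ∘ g) := Complex.ofRealCLM.contDiff.comp hg
  have := h (hg₁.toSchwartzMap hg₂)
  simpa using this

theorem locallyIntegrable_coe (f : L2) : LocallyIntegrable f volume :=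
  (Lp.memLp f).locallyIntegrable one_le_two

theorem fourier_eq_fourierL2 (f : L2) : 𝓕 f = fourierL2 f := rfl

theorem fourierInv_eq_fourierL2_symm (f : L2) : 𝓕⁻ f = fourierL2.symm f := rfl

/-- The `L²` transform agrees with the distributional one by construction; moving `𝓕` off the test
function identifies it with the integral. -/
theorem fourierL2_ae_eq (f : L2) (hf : Integrable f volume) :
    fourierL2 f =ᵐ[volume] 𝓕 (f : E3 → ℂ) := by
  refine ae_eq_of_forall_schwartz (locallyIntegrable_coe _)
    (continuous_fourier_of_integrable hf).locallyIntegrable fun φ => ?_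
  have h := congrArg (fun T => T φ) (Lp.fourier_toTemperedDistribution_eq f)
  simp only [TemperedDistribution.fourier_apply, Lp.toTemperedDistribution_apply, smul_eq_mul,
    SchwartzMap.fourier_coe, fourier_eq_fourierL2] at h
  rw [← integral_fourier_mul_eq φ.integrable hf]
  exact h.symm

theorem fourierL2_symm_ae_eq (f : L2) (hf : Integrable f volume) :
    fourierL2.symm f =ᵐ[volume] 𝓕⁻ (f : E3 → ℂ) := by
  refine ae_eq_of_forall_schwartz (locallyIntegrable_coe _) ?_ fun φ => ?_
  · have hc : Continuous (𝓕⁻ (f : E3 → ℂ)) := by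
      have : 𝓕⁻ (f : E3 → ℂ) = fun x => 𝓕 (f : E3 → ℂ) (-x) :=
        funext fun x => Real.fourierInv_eq_fourier_neg _ x
      rw [this]
      exact (continuous_fourier_of_integrable hf).comp continuous_neg
    exact hc.locallyIntegrable
  have h := congrArg (fun T => T φ) (Lp.fourierInv_toTemperedDistribution_eq f)
  simp only [TemperedDistribution.fourierInv_apply, Lp.toTemperedDistribution_apply, smul_eq_mul,
    SchwartzMap.fourierInv_coe, fourierInv_eq_fourierL2_symm] at h
  rw [← integral_fourierInv_mul_eq φ.integrable hf]
  exact h.symm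

theorem hasBoundedKernel_fourierL2_symm :
    HasBoundedKernel (fourierL2.symm.toContinuousLinearEquiv : L2 →L[ℂ] L2) 1 := by
  refine ⟨fun x y => Complex.exp (((2 * Real.pi * ⟪y, x⟫_ℝ : ℝ) : ℂ) * Complex.I), fun x => ?_,
    fun x y => (Complex.norm_exp_ofReal_mul_I _).le, fun g hg => ?_⟩
  · fun_prop
  · rw [ContinuousLinearEquiv.coe_coe, LinearIsometryEquiv.coe_toContinuousLinearEquiv]
    filter_upwards [fourierL2_symm_ae_eq g hg] with x hx
    rw [hx, Real.fourierInv_eq']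
    simp only [smul_eq_mul]

theorem tendsto_mulCLM {m : ℕ → E3 → ℂ} {m' : E3 → ℂ} (hm : ∀ n, Measurable (m n))
    (hb : ∀ n x, ‖m n x‖ ≤ 1) (hm' : Measurable m') (hb' : ∀ x, ‖m' x‖ ≤ 1)
    (h : ∀ x, Filter.Tendsto (fun n => m n x) Filter.atTop (nhds (m' x))) (f : L2) :
    Filter.Tendsto (fun n => mulCLM (m n) (hm n) (hb n) f) Filter.atTop
      (nhds (mulCLM m' hm' hb' f)) := by
  rw [tendsto_iff_norm_sub_tendsto_zero]
  have hsq : ∀ n, ‖mulCLM (m n) (hm n) (hb n) f - mulCLM m' hm' hb' f‖ₑ ^ 2 =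
      ∫⁻ x, ‖(m n x - m' x) * f x‖ₑ ^ 2 := fun n => by
    rw [enorm_sq_eq_lintegral]
    refine lintegral_congr_ae ?_
    filter_upwards [Lp.coeFn_sub (mulCLM (m n) (hm n) (hb n) f) (mulCLM m' hm' hb' f),
      mulCLM_ae (m n) (hm n) (hb n) f, mulCLM_ae m' hm' hb' f] with x h1 h2 h3
    rw [h1, Pi.sub_apply, h2, h3, sub_mul]
  have hlim : Filter.Tendsto (fun n => ∫⁻ x, ‖(m n x - m' x) * f x‖ₑ ^ 2) Filter.atTop
      (nhds (∫⁻ _ : E3, 0)) := by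
    refine tendsto_lintegral_of_dominated_convergence (fun x => 4 * ‖f x‖ₑ ^ 2) (fun n => ?_)
      (fun n => ?_) ?_ ?_
    · exact ((((hm n).sub hm').mul (measurable_coe f)).enorm).pow_const 2
    · refine Filter.Eventually.of_forall fun x => ?_
      have h2 : ‖m n x - m' x‖ₑ ≤ 2 := by
        have : ‖m n x - m' x‖ ≤ 2 := by
          refine (norm_sub_le _ _).trans ?_
          linarith [hb n x, hb' x]
        simpa using enorm_le_ofReal this
      calc ‖(m n x - m' x) * f x‖ₑ ^ 2 = ‖m n x - m' x‖ₑ ^ 2 * ‖f x‖ₑ ^ 2 := by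
            rw [enorm_mul, mul_pow]
        _ ≤ 2 ^ 2 * ‖f x‖ₑ ^ 2 := by gcongr
        _ = _ := by norm_num
    · rw [lintegral_const_mul _ ((measurable_coe f).enorm.pow_const 2), ← enorm_sq_eq_lintegral]
      exact ENNReal.mul_ne_top (by simp) (ENNReal.pow_ne_top enorm_ne_top)
    · refine Filter.Eventually.of_forall fun x => ?_
      have h1 : Filter.Tendsto (fun n => (m n x - m' x) * f x) Filter.atTop (nhds 0) := by
        simpa using ((h x).sub_const (m' x)).mul_const (f x)
      have h2 := ((continuous_enorm.tendsto (0 : ℂ)).comp h1)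
      have h3 : Filter.Tendsto (fun n => ‖(m n x - m' x) * f x‖ₑ ^ 2) Filter.atTop
          (nhds (‖(0 : ℂ)‖ₑ ^ 2)) := ((ENNReal.continuous_pow 2).tendsto _).comp h2
      rwa [enorm_zero, zero_pow two_ne_zero] at h3
  simp_rw [← hsq] at hlim
  rw [lintegral_zero] at hlim
  have h4 := ((ENNReal.tendsto_toReal ENNReal.zero_ne_top).comp hlim).sqrt
  rw [ENNReal.toReal_zero, Real.sqrt_zero] at h4
  refine h4.congr fun n => ?_
  rw [Function.comp_apply, ENNReal.toReal_pow, toReal_enorm, Real.sqrt_sq (norm_nonneg _)]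

/-- The Gaussian convolution kernel `(π/b)^{3/2} e^{-π²|x-y|²/b}`, the inverse Fourier transform of
`e^{-b|ξ|²}`. -/
def gaussKernel (b : ℂ) (x y : E3) : ℂ :=
  (Real.pi / b) ^ (3 / 2 : ℂ) * Complex.exp (-Real.pi ^ 2 * ‖x - y‖ ^ 2 / b)

theorem measurable_gaussKernel (b : ℂ) (x : E3) : Measurable (gaussKernel b x) := by
  unfold gaussKernel
  fun_prop

theorem norm_gaussKernel_le {b : ℂ} (hb : b ≠ 0) (hre : 0 ≤ b.re) (x y : E3) :
    ‖gaussKernel b x y‖ ≤ (Real.pi / ‖b‖) ^ (3 / 2 : ℝ) := by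
  have hz : (Real.pi / b : ℂ) ≠ 0 := div_ne_zero (by exact_mod_cast Real.pi_ne_zero) hb
  have e1 : ‖(Real.pi / b : ℂ) ^ (3 / 2 : ℂ)‖ = (Real.pi / ‖b‖) ^ (3 / 2 : ℝ) := by
    have : (3 / 2 : ℂ) = ((3 / 2 : ℝ) : ℂ) := by push_cast; rfl
    rw [this, Complex.norm_cpow_of_ne_zero hz]
    simp [abs_of_pos Real.pi_pos]
  have e2 : ‖Complex.exp (-Real.pi ^ 2 * ‖x - y‖ ^ 2 / b)‖ ≤ 1 := by
    rw [Complex.norm_exp, Real.exp_le_one_iff]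
    have : (-Real.pi ^ 2 * ‖x - y‖ ^ 2 / b : ℂ) =
        ((-(Real.pi ^ 2 * ‖x - y‖ ^ 2) : ℝ) : ℂ) * b⁻¹ := by
      push_cast; ring
    rw [this, Complex.re_ofReal_mul, Complex.inv_re]
    have h1 : 0 ≤ b.re / Complex.normSq b := div_nonneg hre (Complex.normSq_nonneg _)
    have h2 : 0 ≤ Real.pi ^ 2 * ‖x - y‖ ^ 2 := by positivity
    nlinarith
  rw [gaussKernel, norm_mul, e1]
  exact mul_le_of_le_one_right (by positivity) e2

theorem integrable_gaussian {b : ℂ} (hb : 0 < b.re) (x : E3) :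
    Integrable (fun v : E3 => Complex.exp (-b * ‖v‖ ^ 2 + 2 * Real.pi * Complex.I * ⟪x, v⟫_ℝ)) :=
  GaussianFourier.integrable_cexp_neg_mul_sq_norm_add hb (2 * Real.pi * Complex.I) x

/-- The symbol of a damped Gaussian multiplier. -/
def gaussSymbol (b : ℂ) (ξ : E3) : ℂ := Complex.exp (-b * ‖ξ‖ ^ 2)

theorem measurable_gaussSymbol (b : ℂ) : Measurable (gaussSymbol b) := by
  unfold gaussSymbol
  fun_prop

theorem norm_gaussSymbol_le {b : ℂ} (hb : 0 ≤ b.re) (ξ : E3) : ‖gaussSymbol b ξ‖ ≤ 1 := by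
  have : (-b * ‖ξ‖ ^ 2 : ℂ) = ((‖ξ‖ ^ 2 : ℝ) : ℂ) * (-b) := by push_cast; ring
  rw [gaussSymbol, Complex.norm_exp, Real.exp_le_one_iff, this, Complex.re_ofReal_mul,
    Complex.neg_re]
  nlinarith [sq_nonneg ‖ξ‖]

/-- Positive real part makes the symbol integrable, so the inverse transform is an honest integral;
moving `𝓕` from `g` to the Gaussian produces the explicit kernel. -/
theorem gaussMultiplier_ae {b : ℂ} (hb : 0 < b.re) (g : L2) (hg : Integrable g volume) :
    fourierL2.symm (mulCLM _ (measurable_gaussSymbol b) (norm_gaussSymbol_le hb.le) (fourierL2 g))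
      =ᵐ[volume] fun x => ∫ y, gaussKernel b x y * g y := by
  set h := mulCLM _ (measurable_gaussSymbol b) (norm_gaussSymbol_le hb.le) (fourierL2 g) with hh
  have hae : h =ᵐ[volume] fun ξ => gaussSymbol b ξ * 𝓕 (g : E3 → ℂ) ξ := by
    filter_upwards [mulCLM_ae _ (measurable_gaussSymbol b) (norm_gaussSymbol_le hb.le)
      (fourierL2 g), fourierL2_ae_eq g hg] with ξ h1 h2
    rw [hh, h1, h2]
  have hgs : Integrable (gaussSymbol b) volume := by
    refine (integrable_gaussian hb 0).congr (Filter.Eventually.of_forall fun v => ?_)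
    simp [gaussSymbol]
  have hint : Integrable h volume := by
    refine Integrable.congr ?_ hae.symm
    refine hgs.mul_bdd (c := ∫ y, ‖g y‖)
      (continuous_fourier_of_integrable hg).aestronglyMeasurable
      (Filter.Eventually.of_forall fun ξ => ?_)
    exact VectorFourier.norm_fourierIntegral_le_integral_norm _ _ _ _ _
  filter_upwards [fourierL2_symm_ae_eq h hint] with x hx
  rw [hx, Real.fourierInv_eq']
  have e1 : ∫ v, Complex.exp (((2 * Real.pi * ⟪v, x⟫_ℝ : ℝ) : ℂ) * Complex.I) • h v =
      ∫ v, Complex.exp (-b * ‖v‖ ^ 2 + 2 * Real.pi * Complex.I * ⟪x, v⟫_ℝ) *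
        𝓕 (g : E3 → ℂ) v := by
    refine integral_congr_ae ?_
    filter_upwards [hae] with v hv
    rw [hv, smul_eq_mul, ← mul_assoc, gaussSymbol, ← Complex.exp_add, real_inner_comm x v]
    congr 2
    push_cast
    ring
  rw [e1, ← integral_fourier_mul_eq (integrable_gaussian hb x) hg]
  refine integral_congr_ae (Filter.Eventually.of_forall fun y => ?_)
  have := fourier_gaussian_innerProductSpace' hb x y
  simp only [this, gaussKernel]
  simp

/-- The flow is the Gaussian multiplier with `b = iβ` purely imaginary. It is reached by damping:
multipliers converge in `L²`, hence almost everywhere along a subsequence, and the kernel integrals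
converge by domination. -/
theorem hasBoundedKernel_freeFlow {ħ t : ℝ} (hħ : 0 < ħ) (ht : t ≠ 0) :
    HasBoundedKernel (freeFlow ħ t) ((2 * Real.pi * ħ * |t|)⁻¹ ^ (3 / 2 : ℝ)) := by
  set β : ℝ := 2 * Real.pi ^ 2 * t * ħ with hβ
  have hβ0 : β ≠ 0 := by positivity
  set b : ℂ := β * Complex.I with hb
  have hb0 : b ≠ 0 := by
    rw [hb]; exact mul_ne_zero (by exact_mod_cast hβ0) Complex.I_ne_zero
  have hbre : b.re = 0 := by simp [hb]
  have hbn : ‖b‖ = 2 * Real.pi ^ 2 * |t| * ħ := by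
    rw [hb, norm_mul, Complex.norm_I, mul_one, Complex.norm_real, Real.norm_eq_abs, hβ]
    simp only [abs_mul, abs_two, abs_pow, abs_of_pos Real.pi_pos, abs_of_pos hħ]
  have hκ : (Real.pi / ‖b‖) = (2 * Real.pi * ħ * |t|)⁻¹ := by
    rw [hbn]
    have := abs_pos.2 ht
    field_simp
  refine ⟨gaussKernel b, measurable_gaussKernel b, fun x y => ?_, fun g hg => ?_⟩
  · rw [← hκ]
    exact norm_gaussKernel_le hb0 hbre.ge x y
  set bn : ℕ → ℂ := fun n => ((1 / ((n : ℝ) + 1) : ℝ) : ℂ) + b with hbn'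
  have hbnre : ∀ n, 0 < (bn n).re := fun n => by
    simp only [hbn', Complex.add_re, Complex.ofReal_re, hbre, add_zero]
    positivity
  have hbn0 : ∀ n, bn n ≠ 0 := fun n h => by
    have := hbnre n
    rw [h] at this
    simp at this
  have hlim : Filter.Tendsto bn Filter.atTop (nhds b) := by
    have := (Complex.continuous_ofReal.tendsto 0).comp
      (tendsto_one_div_add_atTop_nhds_zero_nat (𝕜 := ℝ))
    have h := this.add_const b
    rw [Complex.ofReal_zero, zero_add] at h
    exact h
  -- Damping leaves the imaginary part unchanged, so `|bₙ| ≥ |b|` and the undamped kernel bound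
  -- dominates uniformly in `n`.
  have hbnn : ∀ n, ‖b‖ ≤ ‖bn n‖ := fun n => by
    have h1 : ‖b‖ = |(bn n).im| := by
      rw [hbn']
      simp [hb]
    rw [h1]
    exact Complex.abs_im_le_norm _
  have hflow : freeFlow ħ t g = fourierL2.symm (mulCLM _ (measurable_gaussSymbol b)
      (norm_gaussSymbol_le hbre.ge) (fourierL2 g)) := by
    have hs : freeSymbol ħ t = gaussSymbol b := by
      funext ξ
      unfold freeSymbol gaussSymbol
      congr 1
      rw [hb, hβ]
      push_cast
      ring
    simp only [freeFlow, hs, ContinuousLinearMap.comp_apply, ContinuousLinearEquiv.coe_coe,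
      LinearIsometryEquiv.coe_toContinuousLinearEquiv]
  have hconv : Filter.Tendsto (fun n => fourierL2.symm (mulCLM _ (measurable_gaussSymbol (bn n))
      (norm_gaussSymbol_le (hbnre n).le) (fourierL2 g))) Filter.atTop (nhds (freeFlow ħ t g)) := by
    rw [hflow]
    refine (fourierL2.symm.continuous.tendsto _).comp (tendsto_mulCLM _ _ _ _ (fun ξ => ?_) _)
    unfold gaussSymbol
    have hc : Continuous fun c : ℂ => Complex.exp (-c * ‖ξ‖ ^ 2) := by fun_prop
    exact (hc.tendsto b).comp hlim
  obtain ⟨ns, hns, hae⟩ := (tendstoInMeasure_of_tendsto_Lp hconv).exists_seq_tendsto_ae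
  have hall : ∀ᵐ x, ∀ n, fourierL2.symm (mulCLM _ (measurable_gaussSymbol (bn n))
      (norm_gaussSymbol_le (hbnre n).le) (fourierL2 g)) x = ∫ y, gaussKernel (bn n) x y * g y :=
    ae_all_iff.2 fun n => gaussMultiplier_ae (hbnre n) g hg
  filter_upwards [hae, hall] with x hx hx'
  simp only [hx'] at hx
  refine tendsto_nhds_unique hx ?_
  have hdom : Filter.Tendsto (fun n => ∫ y, gaussKernel (bn n) x y * g y) Filter.atTop
      (nhds (∫ y, gaussKernel b x y * g y)) := by
    refine tendsto_integral_of_dominated_convergence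
      (fun y => (Real.pi / ‖b‖) ^ (3 / 2 : ℝ) * ‖g y‖) (fun n => ?_) (hg.norm.const_mul _)
      (fun n => Filter.Eventually.of_forall fun y => ?_)
      (Filter.Eventually.of_forall fun y => ?_)
    · exact (measurable_gaussKernel _ x).aestronglyMeasurable.mul hg.1
    · rw [norm_mul]
      gcongr
      refine (norm_gaussKernel_le (hbn0 n) (hbnre n).le x y).trans ?_
      have := norm_pos_iff.2 hb0
      have := Real.pi_pos
      gcongr
      exact hbnn n
    · refine Filter.Tendsto.mul_const _ ?_
      unfold gaussKernel
      have hpb : Filter.Tendsto (fun n => (Real.pi / bn n : ℂ)) Filter.atTop (nhds (Real.pi / b)) :=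
        tendsto_const_nhds.div hlim hb0
      -- `π/b` is a nonzero imaginary number, off the branch cut, so the power `3/2` is continuous
      -- there.
      have hslit : (Real.pi / b : ℂ) ∈ Complex.slitPlane := by
        rw [Complex.mem_slitPlane_iff]
        right
        have : (Real.pi / b : ℂ) = ((-(Real.pi / β) : ℝ) : ℂ) * Complex.I := by
          rw [hb, div_eq_iff (by rwa [hb] at hb0)]
          have : (β : ℂ) ≠ 0 := by exact_mod_cast hβ0
          push_cast
          field_simp
          rw [Complex.I_sq]
          ring
        rw [this]
        simp [Real.pi_ne_zero, hβ0]
      refine (hpb.cpow tendsto_const_nhds hslit).mul ?_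
      exact (Complex.continuous_exp.tendsto _).comp (tendsto_const_nhds.div hlim hb0)
  exact hdom.comp hns.tendsto_atTop

end Fourier

/-! ### Inverting the weights and commuting them with the flow. -/

section Sandwich

open ContinuousLinearMap (adjoint adjoint_inner_left adjoint_inner_right)

variable {H : Type*} [NormedAddCommGroup H] [InnerProductSpace ℂ H]

/-- The bounded operator `R` is a two-sided inverse of the unbounded operator `W`. -/
structure IsBoundedInverse (W : H →ₗ.[ℂ] H) (R : H →L[ℂ] H) : Prop where
  right_inv : ∀ g, ∃ h : R g ∈ W.domain, W ⟨R g, h⟩ = g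
  left_inv : ∀ f : W.domain, R (W f) = f

/-- Apply the sandwich identity to `f = R g`, for which `W f = g`, and then apply `R`. -/
theorem IsSandwich.eq_comp {W : H →ₗ.[ℂ] H} {R A B : H →L[ℂ] H} (h : IsSandwich W A B)
    (hR : IsBoundedInverse W R) : A = R ∘L B ∘L R := by
  ext1 g
  obtain ⟨hg, hWg⟩ := hR.right_inv g
  obtain ⟨hu, hWu⟩ := h ⟨R g, hg⟩
  have h1 := hR.left_inv ⟨_, hu⟩
  rw [hWu] at h1
  simp only [hWg] at h1
  exact h1.symm

theorem mulOp_ae (m : E3 → ℂ) (f : (mulOp m).domain) :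
    mulOp m f =ᵐ[volume] fun x => m x * (f : L2) x :=
  MemLp.coeFn_toLp f.2

theorem isBoundedInverse_mulOp {m n : E3 → ℂ} (hn : Measurable n) (hb : ∀ x, ‖n x‖ ≤ 1)
    (hmn : ∀ x, m x * n x = 1) : IsBoundedInverse (mulOp m) (mulCLM n hn hb) := by
  constructor
  · intro g
    have hae : (fun x => m x * mulCLM n hn hb g x) =ᵐ[volume] g := by
      filter_upwards [mulCLM_ae n hn hb g] with x hx
      rw [hx, ← mul_assoc, hmn, one_mul]
    have hmem : mulCLM n hn hb g ∈ (mulOp m).domain :=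
      (memLp_congr_ae hae).2 (Lp.memLp g)
    exact ⟨hmem, Lp.ext ((mulOp_ae m ⟨_, hmem⟩).trans hae)⟩
  · intro f
    refine Lp.ext ?_
    filter_upwards [mulCLM_ae n hn hb (mulOp m f), mulOp_ae m f] with x h1 h2
    rw [h1, h2, ← mul_assoc, mul_comm (n x), hmn, one_mul]

/-- The bounded Fourier multiplier `𝓕⁻¹ R 𝓕`. -/
def fourierConj (R : L2 →L[ℂ] L2) : L2 →L[ℂ] L2 :=
  (fourierL2.symm.toContinuousLinearEquiv : L2 →L[ℂ] L2) ∘L R ∘L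
    (fourierL2.toContinuousLinearEquiv : L2 →L[ℂ] L2)

theorem fourierConj_apply (R : L2 →L[ℂ] L2) (f : L2) :
    fourierConj R f = fourierL2.symm (R (fourierL2 f)) := rfl

/-- The unbounded operator `F⁻¹ m F` for a unitary map `F`. -/
def unitaryConjMulOp (F : L2 ≃ₗᵢ[ℂ] L2) (m : E3 → ℂ) : L2 →ₗ.[ℂ] L2 where
  domain := (mulOp m).domain.comap (F.toLinearEquiv : L2 →ₗ[ℂ] L2)
  toFun :=
    (F.symm.toLinearEquiv : L2 →ₗ[ℂ] L2) ∘ₗ (mulOp m).toFun ∘ₗ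
      (F.toLinearEquiv : L2 →ₗ[ℂ] L2).restrict (fun _ hf => hf)

theorem isBoundedInverse_unitaryConjMulOp (F : L2 ≃ₗᵢ[ℂ] L2) {m : E3 → ℂ} {R R' : L2 →L[ℂ] L2}
    (hR : IsBoundedInverse (mulOp m) R) (hR' : ∀ f, R' f = F.symm (R (F f))) :
    IsBoundedInverse (unitaryConjMulOp F m) R' := by
  constructor
  · intro g
    obtain ⟨h, hW⟩ := hR.right_inv (F g)
    have he : F (R' g) = R (F g) := by
      rw [hR', LinearIsometryEquiv.apply_symm_apply]
    have hmem : F (R' g) ∈ (mulOp m).domain := by rwa [he]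
    refine ⟨hmem, ?_⟩
    change F.symm (mulOp m ⟨F (R' g), hmem⟩) = g
    have : (⟨F (R' g), hmem⟩ : (mulOp m).domain) = ⟨R (F g), h⟩ := Subtype.ext he
    rw [this, hW, LinearIsometryEquiv.symm_apply_apply]
  · intro f
    have h := hR.left_inv ⟨F f, f.2⟩
    have e : F (unitaryConjMulOp F m f) = mulOp m ⟨F f, f.2⟩ := F.apply_symm_apply _
    rw [hR', e, h, LinearIsometryEquiv.symm_apply_apply]

theorem isBoundedInverse_fourierMulOp {m : E3 → ℂ} {R : L2 →L[ℂ] L2}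
    (hR : IsBoundedInverse (mulOp m) R) : IsBoundedInverse (fourierMulOp m) (fourierConj R) :=
  isBoundedInverse_unitaryConjMulOp fourierL2 hR (fourierConj_apply R)

theorem adjoint_invWeightCLM (lam : ℝ) {σ : ℝ} (hσ : 0 ≤ σ) :
    adjoint (invWeightCLM lam hσ) = invWeightCLM lam hσ := by
  symm
  rw [ContinuousLinearMap.eq_adjoint_iff]
  intro f g
  rw [L2.inner_def, L2.inner_def]
  refine integral_congr_ae ?_
  filter_upwards [mulCLM_ae _ (measurable_invWeight lam σ) (norm_invWeight_le lam hσ) f,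
    mulCLM_ae _ (measurable_invWeight lam σ) (norm_invWeight_le lam hσ) g] with x hx hy
  rw [invWeightCLM, hx, hy]
  simp only [RCLike.inner_apply, invWeight, map_mul, Complex.conj_ofReal]
  ring

theorem adjoint_fourierConj {R : L2 →L[ℂ] L2} (hR : adjoint R = R) :
    adjoint (fourierConj R) = fourierConj R := by
  symm
  rw [ContinuousLinearMap.eq_adjoint_iff]
  intro f g
  rw [fourierConj_apply, fourierConj_apply, ← fourierL2.inner_map_map,
    LinearIsometryEquiv.apply_symm_apply, ← fourierL2.inner_map_map f,
    LinearIsometryEquiv.apply_symm_apply, ← adjoint_inner_right, hR]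

theorem bracket_rpow_mul_invWeight (lam σ : ℝ) (x : E3) :
    ((bracket (lam • x) ^ σ : ℝ) : ℂ) * invWeight lam σ x = 1 := by
  rw [invWeight, ← Complex.ofReal_mul, ← Real.rpow_add (bracket_pos _), add_neg_cancel,
    Real.rpow_zero, Complex.ofReal_one]

theorem isBoundedInverse_positionWeight {σ : ℝ} (hσ : 0 ≤ σ) :
    IsBoundedInverse (positionWeight σ) (invWeightCLM 1 hσ) :=
  isBoundedInverse_mulOp _ _ fun x => by simpa using bracket_rpow_mul_invWeight 1 σ x

theorem isBoundedInverse_momentumWeight (ħ : ℝ) {σ : ℝ} (hσ : 0 ≤ σ) :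
    IsBoundedInverse (momentumWeight ħ σ) (fourierConj (invWeightCLM (2 * Real.pi * ħ) hσ)) :=
  isBoundedInverse_fourierMulOp
    (isBoundedInverse_mulOp _ _ fun x => bracket_rpow_mul_invWeight (2 * Real.pi * ħ) σ x)

theorem norm_fourierL2_symm_le :
    ‖(fourierL2.symm.toContinuousLinearEquiv : L2 →L[ℂ] L2)‖ ≤ 1 :=
  ContinuousLinearMap.opNorm_le_bound _ zero_le_one fun f => by
    rw [one_mul]; exact (fourierL2.symm.norm_map f).le

theorem norm_fourierL2_le : ‖(fourierL2.toContinuousLinearEquiv : L2 →L[ℂ] L2)‖ ≤ 1 :=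
  ContinuousLinearMap.opNorm_le_bound _ zero_le_one fun f => by
    rw [one_mul]; exact (fourierL2.norm_map f).le

/-- Multiplication by the symbol of the free flow after the Fourier transform. -/
def symbolFourier (ħ t : ℝ) : L2 →L[ℂ] L2 :=
  mulCLM (freeSymbol ħ t) (measurable_freeSymbol ħ t) (norm_freeSymbol_le ħ t) ∘L
    (fourierL2.toContinuousLinearEquiv : L2 →L[ℂ] L2)

theorem norm_symbolFourier_le (ħ t : ℝ) : ‖symbolFourier ħ t‖ ≤ 1 :=
  (ContinuousLinearMap.opNorm_comp_le _ _).trans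
    (mul_le_one₀ (norm_mulCLM_le _ _ (norm_freeSymbol_le ħ t)) (norm_nonneg _) norm_fourierL2_le)

theorem norm_freeFlow_le (ħ t : ℝ) : ‖freeFlow ħ t‖ ≤ 1 :=
  (ContinuousLinearMap.opNorm_comp_le _ _).trans
    (mul_le_one₀ norm_fourierL2_symm_le (norm_nonneg _) (norm_symbolFourier_le ħ t))

theorem mulCLM_comm {m n : E3 → ℂ} (hm : Measurable m) (hbm : ∀ x, ‖m x‖ ≤ 1) (hn : Measurable n)
    (hbn : ∀ x, ‖n x‖ ≤ 1) (f : L2) :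
    mulCLM m hm hbm (mulCLM n hn hbn f) = mulCLM n hn hbn (mulCLM m hm hbm f) := by
  refine Lp.ext ?_
  filter_upwards [mulCLM_ae m hm hbm (mulCLM n hn hbn f), mulCLM_ae n hn hbn (mulCLM m hm hbm f),
    mulCLM_ae m hm hbm f, mulCLM_ae n hn hbn f] with x h1 h2 h3 h4
  rw [h1, h2, h3, h4, mul_left_comm]

/-- Both operators are Fourier multipliers; placing the weight next to `𝓕⁻¹` exposes a kernel
bounded by 1 and leaves a contraction on the right. -/
theorem freeFlow_comp_fourierConj (ħ t lam : ℝ) {σ : ℝ} (hσ : 0 ≤ σ) :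
    freeFlow ħ t ∘L fourierConj (invWeightCLM lam hσ) =
      ((fourierL2.symm.toContinuousLinearEquiv : L2 →L[ℂ] L2) ∘L invWeightCLM lam hσ) ∘L
        symbolFourier ħ t := by
  ext1 f
  simp only [freeFlow, symbolFourier, ContinuousLinearMap.comp_apply, fourierConj_apply,
    ContinuousLinearEquiv.coe_coe, LinearIsometryEquiv.coe_toContinuousLinearEquiv,
    LinearIsometryEquiv.apply_symm_apply]
  rw [invWeightCLM, mulCLM_comm]

theorem evolve_eq_of_isSandwich {W : L2 →ₗ.[ℂ] L2} {R γ B : L2 →L[ℂ] L2} (h : IsSandwich W γ B)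
    (hR : IsBoundedInverse W R) (hadj : adjoint R = R) (ħ t : ℝ) :
    evolve ħ t γ = (freeFlow ħ t ∘L R) ∘L B ∘L adjoint (freeFlow ħ t ∘L R) := by
  rw [evolve, h.eq_comp hR, ContinuousLinearMap.adjoint_comp, hadj]
  simp only [ContinuousLinearMap.comp_assoc]

/-- A bound for each admissible `B` passes to the infimum. When there is no `B`, or its Schatten
norm is infinite, the right side is `∞` because `C` and `ħ` are positive. -/
theorem sandwichNorm_bounds {W : L2 →ₗ.[ℂ] L2} {γ A : L2 →L[ℂ] L2} {r : ℝ≥0∞} {ħ C : ℝ}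
    (hħ : 0 < ħ) (hC : 0 < C)
    (h : ∀ B, IsSandwich W γ B → schattenNorm r B < ∞ → (∃ ρ, IsDensity ħ A ρ) ∧
      ∀ ρ, IsDensity ħ A ρ →
        eLpNorm ρ r volume ≤ ENNReal.ofReal C * scaledSchattenNorm ħ r B) :
    (sandwichNorm ħ r W γ < ∞ → ∃ ρ, IsDensity ħ A ρ) ∧
      ∀ ρ, IsDensity ħ A ρ →
        eLpNorm ρ r volume ≤ ENNReal.ofReal C * sandwichNorm ħ r W γ := by
  have hpos : ENNReal.ofReal ((2 * Real.pi * ħ) ^ (3 * (r⁻¹).toReal)) ≠ 0 := by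
    rw [Ne, ENNReal.ofReal_eq_zero, not_le]
    have := Real.pi_pos
    positivity
  have hC0 : ENNReal.ofReal C ≠ 0 := by rwa [Ne, ENNReal.ofReal_eq_zero, not_le]
  constructor
  · intro hfin
    unfold sandwichNorm at hfin
    simp only [iInf_lt_iff] at hfin
    obtain ⟨B, hB, hBfin⟩ := hfin
    exact (h B hB (ENNReal.lt_top_of_mul_ne_top_right hBfin.ne hpos)).1
  · intro ρ hρ
    unfold sandwichNorm
    rw [ENNReal.mul_iInf_of_ne hC0 ENNReal.ofReal_ne_top]
    refine le_iInf fun B => ?_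
    rw [ENNReal.mul_iInf_of_ne hC0 ENNReal.ofReal_ne_top]
    refine le_iInf fun hB => ?_
    by_cases hS : schattenNorm r B < ∞
    · exact (h B hB hS).2 ρ hρ
    · rw [not_lt, top_le_iff] at hS
      rw [scaledSchattenNorm, hS, ENNReal.mul_top hpos, ENNReal.mul_top hC0]
      exact le_top

end Sandwich

/-! ### Powers of `ħ` and the final bounds. -/

section Main

open ContinuousLinearMap (adjoint)

/-- Passage from a bound on the densities of `(T G' |B|^{1/2}) (T G' |B|^{1/2})*` to the density
of `T G B G* T*`. -/
theorem density_scaledSchattenNorm_bound {r : ℝ≥0∞} (hr : 1 ≤ r) {T G B : L2 →L[ℂ] L2}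
    (hG : ‖G‖ ≤ 1) {ħ d C : ℝ} (hħ : 0 < ħ) (hd : 0 ≤ d) (hS : schattenNorm r B < ∞)
    (h : ∀ G' : L2 →L[ℂ] L2, ‖G'‖ ≤ 1 →
      eLpNorm (localDensity (T ∘L G' ∘L absRoot 1 B)) r volume ≤
        ENNReal.ofReal d * schattenNorm r B)
    {A : L2 →L[ℂ] L2} (hA : A = (T ∘L G) ∘L B ∘L adjoint (T ∘L G))
    (hC : (2 * Real.pi * ħ) ^ 3 * (2 * d) ≤ C * (2 * Real.pi * ħ) ^ (3 * (r⁻¹).toReal)) :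
    (∃ ρ, IsDensity ħ A ρ) ∧ ∀ ρ, IsDensity ħ A ρ →
      eLpNorm ρ r volume ≤ ENNReal.ofReal C * scaledSchattenNorm ħ r B := by
  have hpi := Real.pi_pos
  obtain ⟨h1, h2⟩ := exists_isDensity_and_bound hr hG ħ
    (ENNReal.mul_lt_top ENNReal.ofReal_lt_top hS) h hA
  refine ⟨h1, fun ρ hρ => (h2 ρ hρ).trans ?_⟩
  rw [scaledSchattenNorm, ← add_mul, ← ENNReal.ofReal_add hd hd, ← mul_assoc, ← mul_assoc,
    ← ENNReal.ofReal_mul (by positivity), ← ENNReal.ofReal_mul' (by positivity),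
    abs_of_pos (by positivity), ← two_mul]
  gcongr

/-- Used with `x = 2πħ`: the factor `x^3` of the density and the gain `x^{-3/r'}` combine to the
`x^{3/r}` of the scaled Schatten norm. -/
theorem scale_rpow {x α α' : ℝ} (hx : 0 < x) (h : α + α' = 1) :
    x ^ 3 * (1 / x ^ 3) ^ α' = x ^ (3 * α) := by
  rw [one_div, ← Real.rpow_natCast, ← Real.rpow_neg hx.le, ← Real.rpow_mul hx.le,
    ← Real.rpow_add hx]
  congr 1
  push_cast
  linear_combination -3 * h

end Main

end Semiclassical

end

theorem mainTheorem5 (r r' : ℝ≥0∞) (hr : 1 ≤ r) (hrr' : ENNReal.HolderConjugate r r')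
    (σ : ℝ) (hσ : 3 / 2 * (r'⁻¹).toReal < σ) :
    ∃ C : ℝ, 0 < C ∧
      ∀ (ħ : ℝ), 0 < ħ → ∀ (t : ℝ) (γ₀ : Semiclassical.L2 →L[ℂ] Semiclassical.L2),
        ((Semiclassical.sandwichNorm ħ r (Semiclassical.momentumWeight ħ σ) γ₀ < ∞ →
            ∃ ρ, Semiclassical.IsDensity ħ (Semiclassical.evolve ħ t γ₀) ρ) ∧
          ∀ ρ, Semiclassical.IsDensity ħ (Semiclassical.evolve ħ t γ₀) ρ →
            eLpNorm ρ r volume ≤ ENNReal.ofReal C *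
              Semiclassical.sandwichNorm ħ r (Semiclassical.momentumWeight ħ σ) γ₀) ∧
        (t ≠ 0 ∨ r = 1 →
          (Semiclassical.sandwichNorm ħ r (Semiclassical.positionWeight σ) γ₀ < ∞ →
            ∃ ρ, Semiclassical.IsDensity ħ (Semiclassical.evolve ħ t γ₀) ρ) ∧
          ∀ ρ, Semiclassical.IsDensity ħ (Semiclassical.evolve ħ t γ₀) ρ →
            eLpNorm ρ r volume ≤ ENNReal.ofReal (C / |t| ^ (3 * (r'⁻¹).toReal)) *
              Semiclassical.sandwichNorm ħ r (Semiclassical.positionWeight σ) γ₀) := by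
  open Semiclassical in
  set α := (r'⁻¹).toReal with hα
  have hα0 : 0 ≤ α := ENNReal.toReal_nonneg
  have hσ0 : 0 < σ := by linarith
  have hsum : (r⁻¹).toReal + α = 1 := toReal_inv_add_toReal_inv r r'
  have hw := weightConst_pos hσ
  have hpi := Real.pi_pos
  -- The 2 counts the densities of `XX*` and `YY*`; the summand 1 covers the case `r = 1`, where the
  -- plain operator bound is 1.
  refine ⟨2 * (weightConst σ α + 1), by positivity, fun ħ hħ t γ₀ => ⟨?_, fun ht => ?_⟩⟩
  · refine sandwichNorm_bounds hħ (by positivity) fun B hB hS => ?_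
    have hA := evolve_eq_of_isSandwich hB (isBoundedInverse_momentumWeight ħ hσ0.le)
      (adjoint_fourierConj (adjoint_invWeightCLM _ _)) ħ t
    rw [freeFlow_comp_fourierConj] at hA
    refine density_scaledSchattenNorm_bound hr (norm_symbolFourier_le ħ t) hħ (by positivity) hS
      (fun G' hG' => eLpNorm_localDensity_invWeight_le (r' := r') norm_fourierL2_symm_le hG'
        hasBoundedKernel_fourierL2_symm (by positivity) hσ0 hσ B) hA ?_
    rw [← hα, one_pow, ← scale_rpow (by positivity) hsum]
    have : 0 ≤ (2 * Real.pi * ħ) ^ 3 * (1 / (2 * Real.pi * ħ) ^ 3) ^ α := by positivity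
    nlinarith
  · have hA : ∀ B, IsSandwich (positionWeight σ) γ₀ B → evolve ħ t γ₀ =
        ((freeFlow ħ t ∘L invWeightCLM 1 hσ0.le) ∘L ContinuousLinearMap.id ℂ L2) ∘L B ∘L
          ContinuousLinearMap.adjoint
            ((freeFlow ħ t ∘L invWeightCLM 1 hσ0.le) ∘L ContinuousLinearMap.id ℂ L2) :=
      fun B hB => by
        rw [ContinuousLinearMap.comp_id]
        exact evolve_eq_of_isSandwich hB (isBoundedInverse_positionWeight hσ0.le)
          (adjoint_invWeightCLM _ _) ħ t
    rcases eq_or_ne r 1 with rfl | hr1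
    · have hα1 : α = 0 := by
        rw [inv_one, ENNReal.toReal_one] at hsum
        linarith
      have hT : ‖freeFlow ħ t ∘L invWeightCLM 1 hσ0.le‖ ≤ 1 :=
        (ContinuousLinearMap.opNorm_comp_le _ _).trans (mul_le_one₀ (norm_freeFlow_le ħ t)
          (norm_nonneg _) (norm_mulCLM_le _ _ (norm_invWeight_le 1 hσ0.le)))
      rw [hα1, mul_zero, Real.rpow_zero, div_one, ← hα1]
      refine sandwichNorm_bounds hħ (by positivity) fun B hB hS => ?_
      refine density_scaledSchattenNorm_bound hr ContinuousLinearMap.norm_id_le hħ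
        (by positivity) hS (fun G' hG' => eLpNorm_one_localDensity_le hT hG' B) (hA B hB) ?_
      have e : (2 * Real.pi * ħ) ^ (3 * ((1 : ℝ≥0∞)⁻¹).toReal) = (2 * Real.pi * ħ) ^ 3 := by
        rw [inv_one, ENNReal.toReal_one, mul_one]
        exact_mod_cast Real.rpow_natCast (2 * Real.pi * ħ) 3
      rw [e]
      have : 0 ≤ (2 * Real.pi * ħ) ^ 3 := by positivity
      nlinarith
    · have ht0 : t ≠ 0 := ht.resolve_right hr1
      have htp := abs_pos.2 ht0
      refine sandwichNorm_bounds hħ (by positivity) fun B hB hS => ?_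
      refine density_scaledSchattenNorm_bound hr ContinuousLinearMap.norm_id_le hħ
        (by positivity) hS
        (fun G' hG' => eLpNorm_localDensity_invWeight_le (r' := r') (norm_freeFlow_le ħ t) hG'
          (hasBoundedKernel_freeFlow hħ ht0) one_pos hσ0 hσ B) (hA B hB) ?_
      -- `κ²/λ³` with `λ = 1`: it splits into the semiclassical factor and the dispersive decay
      -- `|t|^{-3}`.
      have e : ((2 * Real.pi * ħ * |t|)⁻¹ ^ (3 / 2 : ℝ)) ^ 2 / 1 ^ 3 =
          (1 / (2 * Real.pi * ħ) ^ 3) * (1 / |t| ^ 3) := by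
        rw [← Real.rpow_natCast, ← Real.rpow_mul (by positivity)]
        norm_num
        rw [mul_pow]
        field_simp
      have e2 : (1 / |t| ^ 3) ^ α = 1 / |t| ^ (3 * α) := by
        rw [Real.div_rpow zero_le_one (by positivity), Real.one_rpow, Real.rpow_mul htp.le]
        norm_num
      rw [← hα, e, Real.mul_rpow (by positivity) (by positivity), e2,
        ← scale_rpow (by positivity) hsum]
      have : 0 ≤ (2 * Real.pi * ħ) ^ 3 * (1 / (2 * Real.pi * ħ) ^ 3) ^ α * (1 / |t| ^ (3 * α)) := by
        positivity
      have e3 : 2 * (weightConst σ α + 1) / |t| ^ (3 * α) =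
          2 * (weightConst σ α + 1) * (1 / |t| ^ (3 * α)) := by ring
      rw [e3]
      nlinarith
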